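/- **Theorem 4.** A binary CSP instance $I$ consists of variables $x_1,\dots,x_n$, a finite domain $\mathcal D(x_i)$ for each variable, and a relation $R_{ij}\subseteq\mathcal D(x_i)\times\mathcal D(x_j)$ for each pair $i\neq j$, where $R_{ji}$ is the transpose of $R_{ij}$. The constraint between $x_i$ and $x_j$ is non-trivial if $R_{ij}\neq\mathcal D(x_i)\times\mathcal D(x_j)$; let $e$ be the number of (unordered) pairs with a non-trivial constraint and $d$ the maximum size of a domain. For $i \ne j$ and $a,b\in\mathcal D(x_i)$ write $b\xrightarrow{ij}a$ if $(b,c)\in R_{ij}\Rightarrow(a,c)\in R_{ij}$ for all $c\in\mathcal D(x_j)$, and write $b\overset{ik}{\rightsquigarrow}a$ if for every $v\in\mathcal D(x_k)$ with $(b,v)\in R_{ik}$ there is $w\in\mathcal D(x_k)$ with $(a,w)\in R_{ik}$ and $v\xrightarrow{k\ell}w$ for all $\ell\notin\{i,k\}$. A value $b\in\mathcal D(x_i)$ is *snake-conditioned snake-substitutable (SCSS)* if for some $j\neq i$, for every $c\in\mathcal D(x_j)$ with $(b,c)\in R_{ij}$ there is $a\in\mathcal D(x_i)\setminus\{b\}$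 such that (1) $b\overset{ik}{\rightsquigarrow}a$ for all $k\notin\{i,j\}$, and (2) there is $g\in\mathcal D(x_j)$ with $(a,g)\in R_{ij}$ and $c\xrightarrow{jm}g$ for all $m\notin\{i,j\}$. An SCSS elimination deletes an SCSS value from its domain. Instances are given to a random access machine (unit cost per operation, words of $O(\log(ed^2))$ bits, space counted in words and including the input) by $n$, $e$, $d$, the sizes of the domains (the values of each variable being named $0,1,2,\dots$), and a list, in any order, of the non-trivial constraints with their relations as boolean $d\times d$ matrices (padded with zeros). Bounds are for instances with $e\geq 1$ and $n=O(e)$, i.e. $n\le Ke$ for an arbitrary constant $K$ on which the constants in the $O(\cdot)$ may depend (for instance, $K=2$ if every variable occurs in a non-trivial constraint). Then: 1. There is a program that decides in $O(ed^3)$ time and $O(ed^2)$ space whether any SCSS elimination is possible in a given binary CSP instance. 2. There is a program that, given a binary CSP instance, applies SCSS eliminations until convergence in $O(end^5)$ time and $O(ed^2)$ space: it outputs the domains of an instance which results from the given one by a sequence of eliminations, each of a value that is SCSS in the current instance, and in which no value is SCSS. Here $n,e,d$ refer to the given instance. The programs depend on nothing, not even on $K$. -/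

import Mathlib

/-! ## Binary CSP instances -/

/-- A binary CSP instance with variables `x_i`, `i : Fin n`: a finite domain for every variable and,
for every pair of distinct variables, a relation between their domains, the relation `rel j i` being
the transpose of `rel i j`. (The diagonal `rel i i` carries no information and is never used.) -/
structure BinCSP (n : ℕ) where
  dom : Fin n → Finset ℕ
  rel : Fin n → Fin n → Finset (ℕ × ℕ)
  rel_subset : ∀ i j, i ≠ j → rel i j ⊆ dom i ×ˢ dom j
  rel_symm : ∀ i j, i ≠ j → ∀ a c, (a, c) ∈ rel i j ↔ (c, a) ∈ rel j i

namespace BinCSP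

variable {n : ℕ}

/-- `I.Arrow i j b a`: the value `a` of `x_i` can replace the value `b` in every pair
`(b, c) ∈ R_ij`. -/
def Arrow (I : BinCSP n) (i j : Fin n) (b a : ℕ) : Prop :=
  ∀ c ∈ I.dom j, (b, c) ∈ I.rel i j → (a, c) ∈ I.rel i j

/-- `I.Snake i k b a`: the value `a` of `x_i` can replace `b` in every pair `(b, d) ∈ R_ik`,
provided `d` is also replaced by a suitable value `e` of `x_k`. -/
def Snake (I : BinCSP n) (i k : Fin n) (b a : ℕ) : Prop :=
  ∀ d ∈ I.dom k, (b, d) ∈ I.rel i k →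
    ∃ e ∈ I.dom k, (a, e) ∈ I.rel i k ∧ ∀ l : Fin n, l ≠ i → l ≠ k → I.Arrow k l d e

/-- The value `b` of `x_i` is snake-conditioned snake-substitutable. -/
def SCSS (I : BinCSP n) (i : Fin n) (b : ℕ) : Prop :=
  b ∈ I.dom i ∧
  ∃ j : Fin n, j ≠ i ∧ ∀ c ∈ I.dom j, (b, c) ∈ I.rel i j →
    ∃ a ∈ I.dom i, a ≠ b ∧
      (∀ k : Fin n, k ≠ i → k ≠ j → I.Snake i k b a) ∧
      (∃ g ∈ I.dom j, (a, g) ∈ I.rel i j ∧ ∀ m : Fin n, m ≠ i → m ≠ j → I.Arrow j m c g)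

/-- Some value can be eliminated by SCSS. -/
def SCSSPossible (I : BinCSP n) : Prop := ∃ (i : Fin n) (b : ℕ), I.SCSS i b

/-- The instance obtained by eliminating the value `b` from the domain of `x_i`
(together with all pairs of constraint relations in which it occurs). -/
def elim (I : BinCSP n) (i : Fin n) (b : ℕ) : BinCSP n where
  dom := Function.update I.dom i ((I.dom i).erase b)
  rel := fun k l => (I.rel k l).filter fun p => ¬(k = i ∧ p.1 = b) ∧ ¬(l = i ∧ p.2 = b)
  rel_subset := by
    intro k l hkl p hp
    obtain ⟨h1, h2, h3⟩ := Finset.mem_filter.1 hp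
    obtain ⟨h4, h5⟩ := Finset.mem_product.1 (I.rel_subset k l hkl h1)
    refine Finset.mem_product.2 ⟨?_, ?_⟩
    · by_cases hk : k = i
      · subst hk
        simpa [h4] using h2
      · simpa [Function.update_of_ne hk] using h4
    · by_cases hl : l = i
      · subst hl
        simpa [h5] using h3
      · simpa [Function.update_of_ne hl] using h5
  rel_symm := by
    intro k l hkl a c
    simp only [Finset.mem_filter, I.rel_symm k l hkl a c]
    tauto

/-- One SCSS elimination: `J` results from `I` by eliminating a value that is SCSS in `I`. -/
def SCSSStep (I J : BinCSP n) : Prop := ∃ (i : Fin n) (b : ℕ), I.SCSS i b ∧ J = I.elim i b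

/-- `J` results from `I` by applying SCSS eliminations, one after the other, until convergence. -/
def SCSSConverges (I J : BinCSP n) : Prop :=
  Relation.ReflTransGen SCSSStep I J ∧ ¬ J.SCSSPossible

/-- The pairs `{i, j}` (written with `i < j`) of variables that constrain each other, that is,
between which there is a non-trivial constraint. -/
def edges (I : BinCSP n) : Finset (Fin n × Fin n) :=
  Finset.univ.filter fun p => p.1 < p.2 ∧ I.rel p.1 p.2 ≠ I.dom p.1 ×ˢ I.dom p.2

/-- The number of non-trivial constraints. -/
def numEdges (I : BinCSP n) : ℕ := I.edges.card

/-- The maximum size of a domain. -/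
def maxDom (I : BinCSP n) : ℕ := Finset.univ.sup fun i => (I.dom i).card

/-- The values of each variable are named `0, 1, 2, …` (as they are in an input to a program). -/
def Numbered (I : BinCSP n) : Prop := ∀ i, I.dom i = Finset.range (I.dom i).card

/-- The list `es` enumerates the non-trivial constraints (in any order, each of them once). -/
def Lists (I : BinCSP n) (es : List (Fin n × Fin n)) : Prop :=
  es.Nodup ∧ es.toFinset = I.edges

/-- The input presented to a program: the numbers `n`, `e`, `d`; the sizes of the `n` domains; the
first and then the second variables of the `e` non-trivial constraints; the relations of these
constraints as boolean `d × d` matrices (row by row, padded with zeros). Trivial constraints are not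
part of the input. -/
def encode (I : BinCSP n) (es : List (Fin n × Fin n)) : List ℕ :=
  [n, es.length, I.maxDom] ++
  List.ofFn (fun i => (I.dom i).card) ++
  es.map (fun p => (p.1 : ℕ)) ++
  es.map (fun p => (p.2 : ℕ)) ++
  es.flatMap (fun p => (List.range (I.maxDom * I.maxDom)).map fun z =>
    if (z / I.maxDom, z % I.maxDom) ∈ I.rel p.1 p.2 then 1 else 0)

end BinCSP

/-! ## Random access machine programs

Structured programs for a random access machine with finitely many registers (those that are named in
the program) and a memory of words with indirect addressing. Every operation takes one step. -/

namespace RAM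

/-- Contents of the registers and of the memory. -/
structure State where
  reg : ℕ → ℕ
  mem : ℕ → ℕ

/-- Expressions: constants, registers, memory access, addition, truncated subtraction,
multiplication, and comparison (with value `1` for true and `0` for false). -/
inductive Exp where
  | lit (k : ℕ)
  | reg (x : ℕ)
  | load (e : Exp)
  | add (e f : Exp)
  | sub (e f : Exp)
  | mul (e f : Exp)
  | lt (e f : Exp)

namespace Exp

def eval (s : State) : Exp → ℕ
  | lit k => k
  | reg x => s.reg x
  | load e => s.mem (e.eval s)
  | add e f => e.eval s + f.eval s
  | sub e f => e.eval s - f.eval s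
  | mul e f => e.eval s * f.eval s
  | lt e f => if e.eval s < f.eval s then 1 else 0

/-- Number of steps for the evaluation: one for every node of the expression. -/
def cost : Exp → ℕ
  | lit _ => 1
  | reg _ => 1
  | load e => e.cost + 1
  | add e f => e.cost + f.cost + 1
  | sub e f => e.cost + f.cost + 1
  | mul e f => e.cost + f.cost + 1
  | lt e f => e.cost + f.cost + 1

/-- The evaluation stays within the bound `B`: all values that occur in it, in particular all
addresses of memory cells that are read, are at most `B`. -/
def Fits (B : ℕ) (s : State) : Exp → Prop
  | lit k => k ≤ B
  | reg x => s.reg x ≤ B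
  | load e => e.Fits B s ∧ s.mem (e.eval s) ≤ B
  | add e f => e.Fits B s ∧ f.Fits B s ∧ e.eval s + f.eval s ≤ B
  | sub e f => e.Fits B s ∧ f.Fits B s
  | mul e f => e.Fits B s ∧ f.Fits B s ∧ e.eval s * f.eval s ≤ B
  | lt e f => e.Fits B s ∧ f.Fits B s ∧ 1 ≤ B

end Exp

/-- Programs: assignment to a register, assignment to the memory cell with a computed address,
composition, branching and loops (a condition holds when its value is not `0`). -/
inductive Prog where
  | skip
  | assign (x : ℕ) (e : Exp)
  | store (addr e : Exp)
  | seq (p q : Prog)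
  | ite (e : Exp) (p q : Prog)
  | loop (e : Exp) (p : Prog)

/-- `Run B p s t s'`: started in the state `s`, the program `p` halts after `t` steps in the state
`s'`, and it runs within space `B`: every memory cell that it reads or writes has an address `≤ B`,
and every number that it computes or stores is `≤ B` (so that `O(log B)` bits suffice for a word). -/
inductive Run (B : ℕ) : Prog → State → ℕ → State → Prop where
  | skip (s : State) : Run B Prog.skip s 1 s
  | assign (x : ℕ) (e : Exp) (s : State) (he : e.Fits B s) :
      Run B (Prog.assign x e) s (e.cost + 1) ⟨Function.update s.reg x (e.eval s), s.mem⟩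
  | store (addr e : Exp) (s : State) (ha : addr.Fits B s) (he : e.Fits B s) :
      Run B (Prog.store addr e) s (addr.cost + e.cost + 1)
        ⟨s.reg, Function.update s.mem (addr.eval s) (e.eval s)⟩
  | seq (p q : Prog) (s₁ s₂ s₃ : State) (t₁ t₂ : ℕ) (hp : Run B p s₁ t₁ s₂)
      (hq : Run B q s₂ t₂ s₃) : Run B (Prog.seq p q) s₁ (t₁ + t₂) s₃
  | ite_true (e : Exp) (p q : Prog) (s s₁ : State) (t : ℕ) (he : e.Fits B s)
      (hc : e.eval s ≠ 0) (hp : Run B p s t s₁) : Run B (Prog.ite e p q) s (e.cost + 1 + t) s₁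
  | ite_false (e : Exp) (p q : Prog) (s s₁ : State) (t : ℕ) (he : e.Fits B s)
      (hc : e.eval s = 0) (hq : Run B q s t s₁) : Run B (Prog.ite e p q) s (e.cost + 1 + t) s₁
  | loop_true (e : Exp) (p : Prog) (s s₁ s₂ : State) (t₁ t₂ : ℕ) (he : e.Fits B s)
      (hc : e.eval s ≠ 0) (hp : Run B p s t₁ s₁) (hl : Run B (Prog.loop e p) s₁ t₂ s₂) :
      Run B (Prog.loop e p) s (e.cost + 1 + t₁ + t₂) s₂
  | loop_false (e : Exp) (p : Prog) (s : State) (he : e.Fits B s) (hc : e.eval s = 0) :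
      Run B (Prog.loop e p) s (e.cost + 1) s

/-- The initial state for the input word list `w`: the input stands in the memory cells
`0, 1, 2, …`, and all other memory cells and all registers hold `0`. -/
def start (w : List ℕ) : State := ⟨fun _ => 0, fun x => w.getD x 0⟩

end RAM

/-! Every quantifier in the definition of an SCSS value is evaluated by counting. Each listed
constraint is read as two directed edges `f`. Tables indexed by an edge and two values record in
turn where arrows fail, which values have a partner in the sense of condition (2), where snakes
fail, and which substitutes exist. Such a table has O(ed²) entries, each a sum over at most d
values, so it costs O(ed³).

The quantifiers over all variables other than the two ends of an edge would cost an additional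
factor. Instead, failures are counted once per variable, over all edges leaving it. The one edge to
be excluded contributes 0 or 1, which another table knows, so the condition reads `count < 1 +
contribution` (`gather_lt_iff`, used in `noArrowCount_lt` and `noSnakeCount_lt`).

Trivial constraints are absent from the input, but arrows and snakes along them hold for every live
replacement. They matter only as the conditioning constraint with x_j: then either the domain of x_j
is empty and the condition is vacuous, or a substitute for a single value of x_j satisfies the snake
condition towards all variables. Conversely such an unconditional substitute makes every other
variable a suitable x_j (`scss_ne_zero`).

For convergence, an eliminated value is only marked as dead (`Models.elim`), and all tables are
recomputed in each round. There are at most nd eliminations, hence O(end⁴) steps, a factor d below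
the claimed bound.

On the machine, all tables come from one scheme, four nested loops around `mem[a] += e`
(`Adds.accumulate`, `Does.phase`). Nineteen arrays of (3 + n + 3e)d² words suffice, which is O(ed²)
because n ≤ Ke. -/

namespace RAM

/-! ### Evaluation of expressions within a space bound -/

/-- The expression `e` evaluates to `v`, and its evaluation stays within the bound `B`. -/
def Ok (B : ℕ) (s : State) (e : Exp) (v : ℕ) : Prop := e.Fits B s ∧ e.eval s = v

section Ok
variable {B : ℕ} {s : State} {e f : Exp} {x y : ℕ}

theorem Ok.lit {k : ℕ} (h : k ≤ B) : Ok B s (.lit k) k := ⟨h, rfl⟩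

theorem Ok.reg {r : ℕ} (hr : s.reg r = x) (h : x ≤ B) : Ok B s (.reg r) x :=
  ⟨by simpa [Exp.Fits, hr] using h, hr⟩

theorem Ok.load (he : Ok B s e x) (hm : s.mem x ≤ B) : Ok B s (.load e) (s.mem x) := by
  obtain ⟨h1, rfl⟩ := he
  exact ⟨⟨h1, hm⟩, rfl⟩

theorem Ok.add (he : Ok B s e x) (hf : Ok B s f y) (h : x + y ≤ B) : Ok B s (.add e f) (x + y) := by
  obtain ⟨h1, rfl⟩ := he
  obtain ⟨h2, rfl⟩ := hf
  exact ⟨⟨h1, h2, h⟩, rfl⟩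

theorem Ok.sub (he : Ok B s e x) (hf : Ok B s f y) : Ok B s (.sub e f) (x - y) := by
  obtain ⟨h1, rfl⟩ := he
  obtain ⟨h2, rfl⟩ := hf
  exact ⟨⟨h1, h2⟩, rfl⟩

theorem Ok.mul (he : Ok B s e x) (hf : Ok B s f y) (h : x * y ≤ B) : Ok B s (.mul e f) (x * y) := by
  obtain ⟨h1, rfl⟩ := he
  obtain ⟨h2, rfl⟩ := hf
  exact ⟨⟨h1, h2, h⟩, rfl⟩

theorem Ok.lt (he : Ok B s e x) (hf : Ok B s f y) (h : 1 ≤ B) :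
    Ok B s (.lt e f) (if x < y then 1 else 0) := by
  obtain ⟨h1, rfl⟩ := he
  obtain ⟨h2, rfl⟩ := hf
  exact ⟨⟨h1, h2, h⟩, rfl⟩

theorem Ok.cast (he : Ok B s e x) (h : x = y) : Ok B s e y := h ▸ he

end Ok

namespace Exp

/-- The test `e = 0`. -/
def isZero (e : Exp) : Exp := .lt e (.lit 1)

/-- The test `e ≠ 0`. -/
def nonZero (e : Exp) : Exp := .lt (.lit 0) e

/-- The test `e ≠ f`. -/
def ne (e f : Exp) : Exp := .add (.lt e f) (.lt f e)

/-- The value of `e` if the test `c` holds, and of `f` otherwise. -/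
def sel (c e f : Exp) : Exp := .add (.mul c e) (.mul (isZero c) f)

end Exp

section Tests
variable {B : ℕ} {s : State} {e f c : Exp} {x y : ℕ} {p q : Prop} [Decidable p] [Decidable q]

theorem Ok.isZero (he : Ok B s e x) (h : 1 ≤ B) : Ok B s e.isZero (if x = 0 then 1 else 0) :=
  (Ok.lt he (Ok.lit h) h).cast (by simp)

theorem Ok.nonZero (he : Ok B s e x) (h : 1 ≤ B) : Ok B s e.nonZero (if x ≠ 0 then 1 else 0) :=
  (Ok.lt (Ok.lit (Nat.zero_le _)) he h).cast (by simp [Nat.pos_iff_ne_zero])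

theorem Ok.not (he : Ok B s e (if p then 1 else 0)) (h : 1 ≤ B) :
    Ok B s e.isZero (if ¬ p then 1 else 0) :=
  (Ok.isZero he h).cast (by by_cases hp : p <;> simp [hp])

theorem Ok.and (he : Ok B s e (if p then 1 else 0)) (hf : Ok B s f (if q then 1 else 0))
    (h : 1 ≤ B) : Ok B s (.mul e f) (if p ∧ q then 1 else 0) := by
  have := Ok.mul he hf (by split_ifs <;> simp [h])
  exact this.cast (by by_cases hp : p <;> by_cases hq : q <;> simp [hp, hq])

theorem Ok.ne (he : Ok B s e x) (hf : Ok B s f y) (h : 1 ≤ B) :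
    Ok B s (e.ne f) (if x ≠ y then 1 else 0) := by
  have := Ok.add (Ok.lt he hf h) (Ok.lt hf he h) (by split_ifs <;> omega)
  exact this.cast (by split_ifs <;> omega)

/-- The selection is arithmetic and not a branch: both alternatives are always evaluated, so both
must stay within the bound, even the one that is discarded. -/
theorem Ok.sel (hc : Ok B s c (if p then 1 else 0)) (he : Ok B s e x) (hf : Ok B s f y)
    (h : 1 ≤ B) (hx : x ≤ B) (hy : y ≤ B) : Ok B s (Exp.sel c e f) (if p then x else y) := by
  have h1 := Ok.mul hc he (by split_ifs <;> simp [hx])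
  have h2 := Ok.mul (Ok.not hc h) hf (by split_ifs <;> simp [hy])
  have := Ok.add h1 h2 (by by_cases hp : p <;> simp [hp, hx, hy])
  exact this.cast (by by_cases hp : p <;> simp [hp])

end Tests

/-! ### Counted loops and programs that add to the memory -/

/-- The state with register `x` set to `v`. -/
def State.setReg (s : State) (x v : ℕ) : State := ⟨Function.update s.reg x v, s.mem⟩

theorem Run.assign_ok {B : ℕ} {s : State} {e : Exp} {v : ℕ} (x : ℕ) (h : Ok B s e v) :
    Run B (.assign x e) s (e.cost + 1) (s.setReg x v) := by
  obtain ⟨h, rfl⟩ := h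
  exact Run.assign x e s h

theorem Run.store_ok {B : ℕ} {s : State} {a e : Exp} {x v : ℕ} (ha : Ok B s a x) (h : Ok B s e v) :
    Run B (.store a e) s (a.cost + e.cost + 1) ⟨s.reg, Function.update s.mem x v⟩ := by
  obtain ⟨h, rfl⟩ := h
  obtain ⟨ha, rfl⟩ := ha
  exact Run.store a e s ha h

/-- The loop `for x = 0, 1, …, N - 1 do p`. -/
def Prog.for (x : ℕ) (N : Exp) (p : Prog) : Prog :=
  .seq (.assign x (.lit 0))
    (.loop (.lt (.reg x) N) (.seq p (.assign x (.add (.reg x) (.lit 1)))))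

/-- The limit `N` is evaluated anew at each test, so the invariant has to fix its value. An
iteration pays `N.cost + 3` for the test and `4` for the increment; the last `N.cost + 7` covers the
initialization and the failing test. -/
theorem Run.for {B x c T : ℕ} {N : Exp} {p : Prog} (Inv : ℕ → State → Prop) (hc : c + 1 ≤ B)
    (hN : ∀ k ≤ c, ∀ s, Inv k s → s.reg x = k → Ok B s N c)
    (hp : ∀ k < c, ∀ s, Inv k s → s.reg x = k →
      ∃ t s', Run B p s t s' ∧ t ≤ T ∧ s'.reg x = k ∧ Inv (k + 1) (s'.setReg x (k + 1)))
    (s : State) (h0 : Inv 0 (s.setReg x 0)) :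
    ∃ t s', Run B (.for x N p) s t s' ∧ t ≤ c * (T + (N.cost + 7)) + (N.cost + 7) ∧
      s'.reg x = c ∧ Inv c s' := by
  -- Induction on the number `m` of iterations that remain.
  have key : ∀ m k, k + m = c → ∀ s, Inv k s → s.reg x = k →
      ∃ t s', Run B (.loop (.lt (.reg x) N) (.seq p (.assign x (.add (.reg x) (.lit 1))))) s t s' ∧
        t ≤ m * (T + (N.cost + 7)) + (N.cost + 3) ∧ s'.reg x = c ∧ Inv c s' := by
    intro m
    induction m with
    | zero =>
      intro k hk s hs hx
      obtain rfl : k = c := by omega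
      have ok := Ok.lt (Ok.reg hx (by omega)) (hN k le_rfl s hs hx) (by omega)
      refine ⟨_, s, Run.loop_false _ _ s ok.1 (by simpa using ok.2), ?_, hx, hs⟩
      simp [Exp.cost]; omega
    | succ m ih =>
      intro k hk s hs hx
      have ok := Ok.lt (Ok.reg hx (by omega)) (hN k (by omega) s hs hx) (by omega)
      obtain ⟨t, s', hr, ht, hx', hi⟩ := hp k (by omega) s hs hx
      obtain ⟨t₂, s₂, hr₂, ht₂, hx₂, hi₂⟩ :=
        ih (k + 1) (by omega) (s'.setReg x (k + 1)) hi (by simp [State.setReg])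
      have ha := Run.assign_ok x
        (Ok.add (Ok.reg hx' (by omega)) (Ok.lit (s := s') (B := B) (k := 1) (by omega)) (by omega))
      refine ⟨_, s₂, Run.loop_true _ _ s _ s₂ _ _ ok.1 ?_ (Run.seq _ _ _ _ _ _ _ hr ha) hr₂, ?_,
        hx₂, hi₂⟩
      · rw [ok.2, if_pos (by omega)]; simp
      · simp only [Exp.cost, Nat.succ_mul] at *; omega
  obtain ⟨t, s', hr, ht, hx, hi⟩ := key c 0 (by omega) (s.setReg x 0) h0 (by simp [State.setReg])
  refine ⟨_, s', Run.seq _ _ _ _ _ _ _ (Run.assign_ok x (Ok.lit (Nat.zero_le _))) hr, ?_, hx, hi⟩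
  simp only [Exp.cost]; omega

/-- Started in a state whose registers below `x` are as in `ρ` and whose memory outside of `D` is as
in `m`, the program `p` adds `Δ` to the memory within `T` steps and keeps the registers
below `x`. -/
def Adds (B : ℕ) (D : Set ℕ) (m : ℕ → ℕ) (x : ℕ) (ρ : ℕ → ℕ) (p : Prog) (Δ : ℕ → ℕ) (T : ℕ) : Prop :=
  ∀ s : State, (∀ r < x, s.reg r = ρ r) → (∀ y ∉ D, s.mem y = m y) → (∀ y, s.mem y + Δ y ≤ B) →
    ∃ t s', Run B p s t s' ∧ t ≤ T ∧ (∀ r < x, s'.reg r = ρ r) ∧ ∀ y, s'.mem y = s.mem y + Δ y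

/-- Only cells in `D` change, while what an iteration adds is determined by the registers and the
cells outside `D`; so the iterations do not influence each other and their contributions sum up. As
contributions are natural numbers, a bound for the final contents bounds all intermediate ones. -/
theorem Adds.for {B : ℕ} {D : Set ℕ} {m : ℕ → ℕ} {x : ℕ} {ρ : ℕ → ℕ} {p : Prog} {N : Exp} {c T : ℕ}
    {Δ : ℕ → ℕ → ℕ} (hc : c + 1 ≤ B) (hD : ∀ k < c, ∀ y ∉ D, Δ k y = 0)
    (hN : ∀ s : State, (∀ r < x, s.reg r = ρ r) → Ok B s N c)
    (hp : ∀ k < c, Adds B D m (x + 1) (Function.update ρ x k) p (Δ k) T) :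
    Adds B D m x ρ (.for x N p) (fun y => ∑ k ∈ Finset.range c, Δ k y)
      (c * (T + (N.cost + 7)) + (N.cost + 7)) := by
  intro s hρ hm hB
  have start : (∀ r < x, (s.setReg x 0).reg r = ρ r) ∧
      ∀ y, (s.setReg x 0).mem y = s.mem y + ∑ i ∈ Finset.range 0, Δ i y := by
    refine ⟨fun r hr => ?_, fun y => by simp [State.setReg]⟩
    simpa [State.setReg, Function.update_of_ne (show r ≠ x by omega)] using hρ r hr
  have step : ∀ k < c, ∀ s' : State, ((∀ r < x, s'.reg r = ρ r) ∧
      ∀ y, s'.mem y = s.mem y + ∑ i ∈ Finset.range k, Δ i y) → s'.reg x = k →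
      ∃ t s'', Run B p s' t s'' ∧ t ≤ T ∧ s''.reg x = k ∧
        ((∀ r < x, (s''.setReg x (k + 1)).reg r = ρ r) ∧ ∀ y, (s''.setReg x (k + 1)).mem y =
          s.mem y + ∑ i ∈ Finset.range (k + 1), Δ i y) := by
    rintro k hk s' ⟨h1, h2⟩ hx
    obtain ⟨t, s'', hr, ht, h3, h4⟩ := hp k hk s'
      (by
        intro r hr
        rcases eq_or_ne r x with rfl | hne
        · simpa using hx
        · rw [Function.update_of_ne hne]; exact h1 r (by omega))
      (by
        intro y hy
        rw [h2, hm y hy, Finset.sum_eq_zero, add_zero]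
        intro i hi
        exact hD i (by have := Finset.mem_range.1 hi; omega) y hy)
      (by
        intro y
        rw [h2, add_assoc, ← Finset.sum_range_succ (fun i => Δ i y)]
        refine le_trans (Nat.add_le_add_left ?_ _) (hB y)
        exact Finset.sum_le_sum_of_subset (by simpa using hk))
    refine ⟨t, s'', hr, ht, by simpa using h3 x (by omega), ?_, ?_⟩
    · intro r hr
      have := h3 r (by omega)
      rw [Function.update_of_ne (by omega)] at this
      simpa [State.setReg, Function.update_of_ne (show r ≠ x by omega)] using this
    · intro y
      simp only [State.setReg]
      rw [h4, h2, Finset.sum_range_succ, add_assoc]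
  obtain ⟨t, s', hr, ht, -, h⟩ := Run.for _ hc (fun k _ s' h _ => hN s' h.1) step s start
  exact ⟨t, s', hr, ht, h⟩

theorem Adds.store {B : ℕ} {D : Set ℕ} {m : ℕ → ℕ} {x : ℕ} {ρ : ℕ → ℕ} {a e : Exp} {A V : ℕ}
    (hA : A ∈ D)
    (h : ∀ s : State, (∀ r < x, s.reg r = ρ r) → (∀ y ∉ D, s.mem y = m y) → (∀ y, s.mem y ≤ B) →
      Ok B s a A ∧ Ok B s e V) :
    Adds B D m x ρ (.store a (.add (.load a) e)) (fun y => if A = y then V else 0)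
      (2 * a.cost + e.cost + 3) := by
  intro s hρ hm hB
  obtain ⟨h1, h2⟩ := h s hρ hm fun y => le_trans (Nat.le_add_right _ _) (hB y)
  have hBA : s.mem A + V ≤ B := by simpa using hB A
  refine ⟨_, _, Run.store_ok h1 (Ok.add (Ok.load h1 (by omega)) h2 hBA), ?_, hρ, ?_⟩
  · simp only [Exp.cost]; omega
  · intro y
    rcases eq_or_ne y A with rfl | hne
    · simp
    · simp [Function.update_of_ne hne, hne.symm]

/-- Four nested loops (with variables in the registers `7, 8, 9, 10`) around `mem[a] += e`. -/
def Prog.accumulate (N₁ N₂ N₃ N₄ a e : Exp) : Prog :=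
  .for 7 N₁ (.for 8 N₂ (.for 9 N₃ (.for 10 N₄ (.store a (.add (.load a) e)))))

/-- A factor for the running time of `Prog.accumulate`. -/
def Prog.accumulateCost (N₁ N₂ N₃ N₄ a e : Exp) : ℕ :=
  (2 * a.cost + e.cost + 3) * (2 * N₄.cost + 15) * (2 * N₃.cost + 15) * (2 * N₂.cost + 15) *
    (2 * N₁.cost + 15)

/-- With at least one iteration, the overhead outside the iterations can be charged to them. The
time of nested loops then stays a pure product of the ranges, times a factor that depends only on
the expressions. -/
theorem loop_time_le {c T u m : ℕ} (hc : 1 ≤ c) (hm : 1 ≤ m) (hT : T ≤ m) :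
    c * (T + (u + 7)) + (u + 7) ≤ c * (m * (2 * u + 15)) := by
  have h1 : c * (T + (u + 7)) + (u + 7) ≤ c * (T + (u + 7)) + c * (u + 7) :=
    Nat.add_le_add_left (Nat.le_mul_of_pos_left _ hc) _
  refine h1.trans ?_
  rw [← mul_add]
  refine Nat.mul_le_mul_left _ ?_
  nlinarith

/-- Target address and summand have to be functions of the four loop counters alone. This holds when
they are computed from registers and from cells outside `D`. -/
theorem Adds.accumulate {B : ℕ} {D : Set ℕ} {m ρ : ℕ → ℕ} {N₁ N₂ N₃ N₄ a e : Exp} {c₁ c₂ c₃ c₄ : ℕ}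
    {A V : ℕ → ℕ → ℕ → ℕ → ℕ} (h₁ : c₁ + 1 ≤ B) (h₂ : c₂ + 1 ≤ B) (h₃ : c₃ + 1 ≤ B) (h₄ : c₄ + 1 ≤ B)
    (p₁ : 1 ≤ c₁) (p₂ : 1 ≤ c₂) (p₃ : 1 ≤ c₃) (p₄ : 1 ≤ c₄)
    (hN : ∀ s : State, (∀ r < 7, s.reg r = ρ r) →
      Ok B s N₁ c₁ ∧ Ok B s N₂ c₂ ∧ Ok B s N₃ c₃ ∧ Ok B s N₄ c₄)
    (h : ∀ s : State, (∀ r < 7, s.reg r = ρ r) → (∀ y ∉ D, s.mem y = m y) → (∀ y, s.mem y ≤ B) →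
      s.reg 7 < c₁ → s.reg 8 < c₂ → s.reg 9 < c₃ → s.reg 10 < c₄ →
      A (s.reg 7) (s.reg 8) (s.reg 9) (s.reg 10) ∈ D ∧
      Ok B s a (A (s.reg 7) (s.reg 8) (s.reg 9) (s.reg 10)) ∧
      Ok B s e (V (s.reg 7) (s.reg 8) (s.reg 9) (s.reg 10)))
    (hA : ∀ f < c₁, ∀ v < c₂, ∀ w < c₃, ∀ z < c₄, A f v w z ∈ D) :
    Adds B D m 7 ρ (.accumulate N₁ N₂ N₃ N₄ a e)
      (fun y => ∑ f ∈ Finset.range c₁, ∑ v ∈ Finset.range c₂, ∑ w ∈ Finset.range c₃,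
        ∑ z ∈ Finset.range c₄, if A f v w z = y then V f v w z else 0)
      (Prog.accumulateCost N₁ N₂ N₃ N₄ a e * (c₁ * c₂ * c₃ * c₄)) := by
  have hz : ∀ f < c₁, ∀ v < c₂, ∀ w < c₃, ∀ z < c₄, ∀ y ∉ D,
      (if A f v w z = y then V f v w z else 0) = 0 := by
    intro f hf v hv w hw z hz y hy
    rw [if_neg]
    rintro rfl
    exact hy (hA f hf v hv w hw z hz)
  have mem := @Finset.mem_range
  have main : Adds B D m 7 ρ (.accumulate N₁ N₂ N₃ N₄ a e)
      (fun y => ∑ f ∈ Finset.range c₁, ∑ v ∈ Finset.range c₂, ∑ w ∈ Finset.range c₃,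
        ∑ z ∈ Finset.range c₄, if A f v w z = y then V f v w z else 0)
      (c₁ * ((c₂ * ((c₃ * ((c₄ * ((2 * a.cost + e.cost + 3) + (N₄.cost + 7)) + (N₄.cost + 7)) +
        (N₃.cost + 7)) + (N₃.cost + 7)) + (N₂.cost + 7)) + (N₂.cost + 7)) + (N₁.cost + 7)) +
        (N₁.cost + 7)) := by
    refine Adds.for h₁ ?_ (fun s hs => (hN s hs).1) fun f hf =>
      Adds.for h₂ ?_ (fun s hs => (hN s fun r hr => ?_).2.1) fun v hv =>
      Adds.for h₃ ?_ (fun s hs => (hN s fun r hr => ?_).2.2.1) fun w hw =>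
      Adds.for h₄ ?_ (fun s hs => (hN s fun r hr => ?_).2.2.2) fun z hz' =>
      Adds.store (V := V f v w z) (hA f hf v hv w hw z hz') fun s hs hm hB => ?_
    · exact fun f hf y hy => Finset.sum_eq_zero fun v hv => Finset.sum_eq_zero fun w hw =>
        Finset.sum_eq_zero fun z hz' => hz f hf v (mem.1 hv) w (mem.1 hw) z (mem.1 hz') y hy
    · exact fun v hv y hy => Finset.sum_eq_zero fun w hw =>
        Finset.sum_eq_zero fun z hz' => hz f hf v hv w (mem.1 hw) z (mem.1 hz') y hy
    · rw [hs r (by omega), Function.update_of_ne (by omega)]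
    · exact fun w hw y hy =>
        Finset.sum_eq_zero fun z hz' => hz f hf v hv w hw z (mem.1 hz') y hy
    · rw [hs r (by omega), Function.update_of_ne (by omega), Function.update_of_ne (by omega)]
    · exact fun z hz' y hy => hz f hf v hv w hw z hz' y hy
    · rw [hs r (by omega), Function.update_of_ne (by omega), Function.update_of_ne (by omega),
        Function.update_of_ne (by omega)]
    · have e7 : s.reg 7 = f := by rw [hs 7 (by omega)]; simp [Function.update]
      have e8 : s.reg 8 = v := by rw [hs 8 (by omega)]; simp [Function.update]
      have e9 : s.reg 9 = w := by rw [hs 9 (by omega)]; simp [Function.update]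
      have e10 : s.reg 10 = z := by rw [hs 10 (by omega)]; simp [Function.update]
      have := h s (fun r hr => by
        rw [hs r (by omega), Function.update_of_ne (by omega), Function.update_of_ne (by omega),
          Function.update_of_ne (by omega), Function.update_of_ne (by omega)]) hm hB
      rw [e7, e8, e9, e10] at this
      exact (this hf hv hw hz').2
  intro s hρ hm hB
  obtain ⟨t, s', hr, ht, h5⟩ := main s hρ hm hB
  refine ⟨t, s', hr, ht.trans ?_, h5⟩
  have t4 := loop_time_le (u := N₄.cost) p₄ (m := 2 * a.cost + e.cost + 3) (by omega) le_rfl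
  have t3 := loop_time_le (u := N₃.cost) p₃ (Nat.mul_pos p₄ (Nat.mul_pos (by omega) (by omega))) t4
  have t2 := loop_time_le (u := N₂.cost) p₂
    (Nat.mul_pos p₃ (Nat.mul_pos (Nat.mul_pos p₄ (Nat.mul_pos (by omega) (by omega))) (by omega))) t3
  have t1 := loop_time_le (u := N₁.cost) p₁ (Nat.mul_pos p₂ (Nat.mul_pos (Nat.mul_pos p₃
    (Nat.mul_pos (Nat.mul_pos p₄ (Nat.mul_pos (by omega) (by omega))) (by omega))) (by omega))) t2
  refine t1.trans (le_of_eq ?_)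
  simp only [Prog.accumulateCost]
  ring

end RAM

/-! ### Counting sums -/

/-- Sums over `f < F` with `κ f = k` and over `z < Z`. -/
def gather (F Z : ℕ) (κ : ℕ → ℕ) (V : ℕ → ℕ → ℕ → ℕ → ℕ) (k v w : ℕ) : ℕ :=
  ∑ f ∈ Finset.range F, if κ f = k then ∑ z ∈ Finset.range Z, V f v w z else 0

theorem gather_id {F Z : ℕ} {V : ℕ → ℕ → ℕ → ℕ → ℕ} {k v w : ℕ} (hk : k < F) :
    gather F Z id V k v w = ∑ z ∈ Finset.range Z, V k v w z := by
  simp [gather, hk]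

theorem gather_id_of_le {F Z : ℕ} {V : ℕ → ℕ → ℕ → ℕ → ℕ} {k v w : ℕ} (hk : F ≤ k) :
    gather F Z id V k v w = 0 := by
  refine Finset.sum_eq_zero fun f hf => if_neg ?_
  have := Finset.mem_range.1 hf
  simp only [id]
  omega

theorem gather_le {F Z M : ℕ} {κ : ℕ → ℕ} {V : ℕ → ℕ → ℕ → ℕ → ℕ} {k v w : ℕ}
    (hV : ∀ f < F, ∀ z < Z, V f v w z ≤ M) : gather F Z κ V k v w ≤ F * (Z * M) := by
  have : ∀ f ∈ Finset.range F,
      (if κ f = k then ∑ z ∈ Finset.range Z, V f v w z else 0) ≤ Z * M := by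
    intro f hf
    split_ifs
    · have := Finset.sum_le_card_nsmul (Finset.range Z) (fun z => V f v w z) M
        (fun z hz => hV f (Finset.mem_range.1 hf) z (Finset.mem_range.1 hz))
      simpa using this
    · exact Nat.zero_le _
  simpa [gather] using Finset.sum_le_card_nsmul _ _ _ this

theorem gather_eq_zero {F Z : ℕ} {κ : ℕ → ℕ} {P : ℕ → ℕ → ℕ → ℕ → Prop}
    [∀ f v w z, Decidable (P f v w z)] {k v w : ℕ} :
    gather F Z κ (fun f v w z => if P f v w z then 1 else 0) k v w = 0 ↔
      ∀ f < F, κ f = k → ∀ z < Z, ¬ P f v w z := by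
  simp only [gather, Finset.sum_eq_zero_iff, Finset.mem_range]
  refine forall₂_congr fun f _ => ?_
  by_cases h : κ f = k <;> simp [h]

theorem gather_id_eq_zero {F Z : ℕ} {P : ℕ → ℕ → ℕ → ℕ → Prop}
    [∀ f v w z, Decidable (P f v w z)] {k v w : ℕ} (hk : k < F) :
    gather F Z id (fun f v w z => if P f v w z then 1 else 0) k v w = 0 ↔
      ∀ z < Z, ¬ P k v w z := by
  rw [gather_eq_zero]
  exact ⟨fun h => h k hk rfl, fun h f _ hfk => by obtain rfl : f = k := hfk; exact h⟩

/-- All indices except possibly `f₀` are known not to satisfy `P` if the number of those that do is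
at most the number (`0` or `1`) of those among `{f₀}` that do. -/
theorem gather_lt_iff {F : ℕ} {κ : ℕ → ℕ} {P : ℕ → ℕ → ℕ → ℕ → Prop}
    [∀ f v w z, Decidable (P f v w z)] {k v w f₀ : ℕ} (hf₀ : f₀ < F) (hk : κ f₀ = k)
    {q : Prop} [Decidable q] (hq : P f₀ v w 0 ↔ q) :
    gather F 1 κ (fun f v w z => if P f v w z then 1 else 0) k v w < 1 + (if q then 1 else 0) ↔
      ∀ f < F, f ≠ f₀ → κ f = k → ¬ P f v w 0 := by
  -- Splitting off `f₀`, whose contribution is exactly the indicator of `q`, turns the comparison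
  -- into the vanishing of the remaining sum.
  have hs : gather F 1 κ (fun f v w z => if P f v w z then 1 else 0) k v w =
      (∑ f ∈ (Finset.range F).erase f₀, if κ f = k then (if P f v w 0 then 1 else 0) else 0) +
        (if q then 1 else 0) := by
    rw [gather, ← Finset.sum_erase_add _ _ (Finset.mem_range.2 hf₀)]
    simp only [Finset.sum_range_one, hk, if_true, hq]
  rw [hs, add_comm 1, add_comm _ (if q then 1 else 0), Nat.add_lt_add_iff_left, Nat.lt_one_iff,
    Finset.sum_eq_zero_iff]
  simp only [Finset.mem_erase, Finset.mem_range, and_imp]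
  constructor
  · intro h f hf hne hκ
    have := h f hne hf
    simpa [hκ] using this
  · intro h f hne hf
    by_cases hκ : κ f = k
    · simp [hκ, h f hf hne hκ]
    · simp [hκ]

/-! ### The tables and their meaning for an instance -/

namespace SCSSTables

/-! The arrays computed in one round, as functions of the arrays with smaller numbers.
Array `1` holds the first and `2` the second variable of a directed edge, `3` the number of the
reverse edge, `4` the relation of the edge in the input; `5` marks the eliminated values. -/

variable (n e d : ℕ) (g : ℕ → ℕ → ℕ → ℕ → ℕ)

/-- Current relations. -/
def rel : ℕ → ℕ → ℕ → ℕ := gather (2 * e) 1 id fun f v w _ =>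
  if g 4 f v w ≠ 0 ∧ g 5 (g 1 f 0 0) v 0 = 0 ∧ g 5 (g 2 f 0 0) w 0 = 0 then 1 else 0

/-- Witnesses against `v → w` along an edge. -/
def noArrow : ℕ → ℕ → ℕ → ℕ := gather (2 * e) d id fun f v w z =>
  if g 6 f v z ≠ 0 ∧ g 6 f w z = 0 then 1 else 0

/-- Number of edges out of a variable along which `v → w` fails. -/
def noArrowCount : ℕ → ℕ → ℕ → ℕ := gather (2 * e) 1 (fun f => g 1 f 0 0) fun f v w _ =>
  if g 7 f v w ≠ 0 then 1 else 0

/-- Partners of `v` along an edge that can replace `w` with respect to all other edges. -/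
def partner : ℕ → ℕ → ℕ → ℕ := gather (2 * e) d id fun f v w z =>
  if g 6 f v z ≠ 0 ∧ g 8 (g 2 f 0 0) w z < 1 + (if g 7 (g 3 f 0 0) w z ≠ 0 then 1 else 0)
    then 1 else 0

/-- Witnesses against `v ⇝ w` along an edge. -/
def noSnake : ℕ → ℕ → ℕ → ℕ := gather (2 * e) d id fun f v w z =>
  if g 6 f v z ≠ 0 ∧ g 9 f w z = 0 then 1 else 0

/-- Number of edges out of a variable along which `v ⇝ w` fails. -/
def noSnakeCount : ℕ → ℕ → ℕ → ℕ := gather (2 * e) 1 (fun f => g 1 f 0 0) fun f v w _ =>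
  if g 10 f v w ≠ 0 then 1 else 0

/-- Substitutes for `v` conditioned by the value `w` at the other end of an edge. -/
def substitute : ℕ → ℕ → ℕ → ℕ := gather (2 * e) d id fun f v w z =>
  if z ≠ v ∧ g 11 (g 1 f 0 0) v z < 1 + (if g 10 f v z ≠ 0 then 1 else 0) ∧ g 9 f z w ≠ 0
    then 1 else 0

/-- Values at the other end of an edge that are partners of `v` and admit no substitute. -/
def noSubstitute : ℕ → ℕ → ℕ → ℕ := gather (2 * e) d id fun f v _ z =>
  if g 6 f v z ≠ 0 ∧ g 12 f v z = 0 then 1 else 0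

/-- Domain sizes. -/
def domSize : ℕ → ℕ → ℕ → ℕ := gather n d id fun f _ _ z => if g 5 f z 0 = 0 then 1 else 0

/-- Number of empty domains. -/
def emptyDoms : ℕ → ℕ → ℕ → ℕ := gather n 1 (fun _ => 0) fun f _ _ _ =>
  if g 14 f 0 0 = 0 then 1 else 0

/-- Unconditional substitutes for `v`. -/
def uncond : ℕ → ℕ → ℕ → ℕ := gather n d id fun f v _ z =>
  if z ≠ v ∧ g 5 f z 0 = 0 ∧ g 11 f v z = 0 then 1 else 0

/-- Number of edges out of a variable that make `v` substitutable. -/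
def condEdges : ℕ → ℕ → ℕ → ℕ := gather (2 * e) 1 (fun f => g 1 f 0 0) fun f v _ _ =>
  if g 13 f v 0 = 0 then 1 else 0

/-- The values that can be eliminated. -/
def scss : ℕ → ℕ → ℕ → ℕ := gather n 1 id fun f v w _ =>
  if w = 0 ∧ g 5 f v 0 = 0 ∧ ¬ (g 15 0 0 0 = 0 ∧ g 16 f v 0 = 0 ∧ g 17 f v 0 = 0) then 1 else 0

/-- The arrays `6` to `18` have been computed. -/
structure Computed : Prop where
  h6 : g 6 = rel e g
  h7 : g 7 = noArrow e d g
  h8 : g 8 = noArrowCount e g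
  h9 : g 9 = partner e d g
  h10 : g 10 = noSnake e d g
  h11 : g 11 = noSnakeCount e g
  h12 : g 12 = substitute e d g
  h13 : g 13 = noSubstitute e d g
  h14 : g 14 = domSize n d g
  h15 : g 15 = emptyDoms n g
  h16 : g 16 = uncond n d g
  h17 : g 17 = condEdges e g
  h18 : g 18 = scss n g

variable {n}

/-- The arrays `1` to `5` represent the instance `J`. -/
structure Models (J : BinCSP n) : Prop where
  src_lt : ∀ f < 2 * e, g 1 f 0 0 < n
  tgt_lt : ∀ f < 2 * e, g 2 f 0 0 < n
  ne : ∀ f < 2 * e, g 1 f 0 0 ≠ g 2 f 0 0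
  rev_lt : ∀ f < 2 * e, g 3 f 0 0 < 2 * e
  src_rev : ∀ f < 2 * e, g 1 (g 3 f 0 0) 0 0 = g 2 f 0 0
  tgt_rev : ∀ f < 2 * e, g 2 (g 3 f 0 0) 0 0 = g 1 f 0 0
  inj : ∀ f < 2 * e, ∀ f' < 2 * e, g 1 f 0 0 = g 1 f' 0 0 → g 2 f 0 0 = g 2 f' 0 0 → f = f'
  dom_lt : ∀ i, ∀ a ∈ J.dom i, a < d
  dead : ∀ i : Fin n, ∀ a < d, g 5 i a 0 = 0 ↔ a ∈ J.dom i
  rel : ∀ f < 2 * e, ∀ i j : Fin n, g 1 f 0 0 = i → g 2 f 0 0 = j → ∀ a ∈ J.dom i, ∀ c ∈ J.dom j,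
    g 4 f a c ≠ 0 ↔ (a, c) ∈ J.rel i j
  triv : ∀ i j : Fin n, i ≠ j → (∀ f < 2 * e, g 1 f 0 0 = i → g 2 f 0 0 ≠ j) →
    ∀ a ∈ J.dom i, ∀ c ∈ J.dom j, (a, c) ∈ J.rel i j

section
variable {e d g} {J : BinCSP n}

theorem _root_.BinCSP.mem_of_rel (J : BinCSP n) {i j : Fin n} (hij : i ≠ j) {a c : ℕ}
    (h : (a, c) ∈ J.rel i j) : a ∈ J.dom i ∧ c ∈ J.dom j :=
  Finset.mem_product.1 (J.rel_subset i j hij h)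

/-- The value `v` of `x_k` can be replaced by `w` in all constraints except the one
with `x_i`. -/
def _root_.BinCSP.ArrowExcept (J : BinCSP n) (i k : Fin n) (v w : ℕ) : Prop :=
  ∀ l : Fin n, l ≠ i → l ≠ k → J.Arrow k l v w

/-- Condition (2) in the definition of SCSS values; it also expresses snakes. -/
def _root_.BinCSP.Partner (J : BinCSP n) (i k : Fin n) (a v : ℕ) : Prop :=
  ∃ w ∈ J.dom k, (a, w) ∈ J.rel i k ∧ J.ArrowExcept i k v w

theorem Models.ne_fin (h : Models e d g J) {f : ℕ} (hf : f < 2 * e) {i j : Fin n}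
    (hi : g 1 f 0 0 = i) (hj : g 2 f 0 0 = j) : i ≠ j := by
  rintro rfl
  exact h.ne f hf (hi.trans hj.symm)

/-- The input matrix is masked by the marks of dead values, so the current relations are available
although the stored matrix is never changed. -/
theorem rel_ne_zero (h : Models e d g J) (c : g 6 = SCSSTables.rel e g) {f : ℕ} (hf : f < 2 * e)
    {i j : Fin n} (hi : g 1 f 0 0 = i) (hj : g 2 f 0 0 = j) {a b : ℕ} (ha : a < d) (hb : b < d) :
    g 6 f a b ≠ 0 ↔ (a, b) ∈ J.rel i j := by
  rw [c, SCSSTables.rel, ne_eq, gather_id_eq_zero hf]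
  simp only [Nat.lt_one_iff, forall_eq, not_not, hi, hj, h.dead i a ha, h.dead j b hb]
  constructor
  · rintro ⟨h1, h2, h3⟩
    exact (h.rel f hf i j hi hj a h2 b h3).1 h1
  · intro hr
    obtain ⟨h2, h3⟩ := J.mem_of_rel (h.ne_fin hf hi hj) hr
    exact ⟨(h.rel f hf i j hi hj a h2 b h3).2 hr, h2, h3⟩

theorem noArrow_eq_zero (h : Models e d g J) (c : Computed n e d g) {f : ℕ} (hf : f < 2 * e)
    {i j : Fin n} (hi : g 1 f 0 0 = i) (hj : g 2 f 0 0 = j) {a b : ℕ} (ha : a < d) (hb : b < d) :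
    g 7 f a b = 0 ↔ J.Arrow i j a b := by
  rw [c.h7, noArrow, gather_id_eq_zero hf]
  constructor
  · intro hz x hx hr
    have hxd := h.dom_lt j x hx
    have := hz x hxd
    rw [rel_ne_zero h c.h6 hf hi hj ha hxd] at this
    exact (rel_ne_zero h c.h6 hf hi hj hb hxd).1 fun h0 => this ⟨hr, h0⟩
  · rintro hA x hxd ⟨h1, h2⟩
    rw [rel_ne_zero h c.h6 hf hi hj ha hxd] at h1
    exact (rel_ne_zero h c.h6 hf hi hj hb hxd).2
      (hA x (J.mem_of_rel (h.ne_fin hf hi hj) h1).2 h1) h2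

/-- A trivial constraint allows every pair of live values. Hence only the replacing value has to be
live, and unlisted constraints can be ignored in the counts. -/
theorem Models.arrow_triv (h : Models e d g J) {i j : Fin n} (hij : i ≠ j)
    (hf : ∀ f < 2 * e, g 1 f 0 0 = i → g 2 f 0 0 ≠ j) {a b : ℕ} (hb : b ∈ J.dom i) :
    J.Arrow i j a b :=
  fun x hx _ => h.triv i j hij hf b hb x hx

/-- The count at x_k includes the edge back to x_i, which is the reverse of `f`; allowing for its
own failure removes it from the condition. A single count per variable and pair of values thus
serves all x_i. Liveness of `w` is needed for the unlisted constraints. -/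
theorem noArrowCount_lt (h : Models e d g J) (c : Computed n e d g) {f : ℕ} (hf : f < 2 * e)
    {i k : Fin n} (hi : g 1 f 0 0 = i) (hk : g 2 f 0 0 = k) {v w : ℕ} (hv : v < d)
    (hw : w ∈ J.dom k) :
    g 8 (g 2 f 0 0) v w < 1 + (if g 7 (g 3 f 0 0) v w ≠ 0 then 1 else 0) ↔
      J.ArrowExcept i k v w := by
  have hwd := h.dom_lt k w hw
  rw [c.h8, noArrowCount, gather_lt_iff (h.rev_lt f hf) (h.src_rev f hf) Iff.rfl]
  constructor
  · intro H l hli hlk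
    by_cases hl : ∃ f' < 2 * e, g 1 f' 0 0 = k ∧ g 2 f' 0 0 = l
    · obtain ⟨f', hf', h1, h2⟩ := hl
      -- An edge from x_k to x_l with l ≠ i is not the reverse of `f`, so its failure would be
      -- counted.
      refine (noArrow_eq_zero h c hf' h1 h2 hv hwd).1 (not_not.1 (H f' hf' ?_ (by rw [h1, hk])))
      rintro rfl
      rw [h.tgt_rev f hf, hi] at h2
      exact hli (Fin.ext h2).symm
    · push Not at hl
      exact h.arrow_triv (Ne.symm hlk) hl hw
  · intro H f' hf' hne h1
    rw [not_not]
    rw [hk] at h1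
    obtain ⟨l, hl⟩ : ∃ l : Fin n, g 2 f' 0 0 = l := ⟨⟨_, h.tgt_lt f' hf'⟩, rfl⟩
    refine (noArrow_eq_zero h c hf' h1 hl hv hwd).2 (H l ?_ (h.ne_fin hf' h1 hl).symm)
    rintro rfl
    refine hne (h.inj _ hf' _ (h.rev_lt f hf) ?_ ?_)
    · rw [h.src_rev f hf, h1, hk]
    · rw [h.tgt_rev f hf, hl, hi]

theorem partner_ne_zero (h : Models e d g J) (c : Computed n e d g) {f : ℕ} (hf : f < 2 * e)
    {i k : Fin n} (hi : g 1 f 0 0 = i) (hk : g 2 f 0 0 = k) {a v : ℕ} (ha : a < d) (hv : v < d) :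
    g 9 f a v ≠ 0 ↔ J.Partner i k a v := by
  rw [c.h9, partner, ne_eq, gather_id_eq_zero hf]
  push Not
  constructor
  · rintro ⟨w, hw, h1, h2⟩
    rw [rel_ne_zero h c.h6 hf hi hk ha hw] at h1
    -- The table does not test whether `w` is live; this follows from its occurring in a current
    -- relation.
    have hwk := (J.mem_of_rel (h.ne_fin hf hi hk) h1).2
    exact ⟨w, hwk, h1, (noArrowCount_lt h c hf hi hk hv hwk).1 h2⟩
  · rintro ⟨w, hw, h1, h2⟩
    exact ⟨w, h.dom_lt k w hw, (rel_ne_zero h c.h6 hf hi hk ha (h.dom_lt k w hw)).2 h1,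
      (noArrowCount_lt h c hf hi hk hv hw).2 h2⟩

/-- Snakes unfold to condition (2) for all partners of `b`, so both are served by the one table of
partners. -/
theorem _root_.BinCSP.snake_iff (J : BinCSP n) (i k : Fin n) (b a : ℕ) :
    J.Snake i k b a ↔ ∀ v ∈ J.dom k, (b, v) ∈ J.rel i k → J.Partner i k a v := Iff.rfl

theorem noSnake_eq_zero (h : Models e d g J) (c : Computed n e d g) {f : ℕ} (hf : f < 2 * e)
    {i k : Fin n} (hi : g 1 f 0 0 = i) (hk : g 2 f 0 0 = k) {b a : ℕ} (hb : b < d) (ha : a < d) :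
    g 10 f b a = 0 ↔ J.Snake i k b a := by
  rw [c.h10, noSnake, gather_id_eq_zero hf, J.snake_iff]
  constructor
  · intro hz v hv hr
    have hvd := h.dom_lt k v hv
    exact (partner_ne_zero h c hf hi hk ha hvd).1 fun h0 =>
      hz v hvd ⟨(rel_ne_zero h c.h6 hf hi hk hb hvd).2 hr, h0⟩
  · rintro hS v hvd ⟨h1, h2⟩
    rw [rel_ne_zero h c.h6 hf hi hk hb hvd] at h1
    exact (partner_ne_zero h c hf hi hk ha hvd).2
      (hS v (J.mem_of_rel (h.ne_fin hf hi hk) h1).2 h1) h2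

/-- Across a trivial constraint `v` need not be replaced: it is allowed together with `a`, and
arrows are reflexive. -/
theorem Models.partner_triv (h : Models e d g J) {i k : Fin n} (hik : i ≠ k)
    (hf : ∀ f < 2 * e, g 1 f 0 0 = i → g 2 f 0 0 ≠ k) {a v : ℕ} (ha : a ∈ J.dom i)
    (hv : v ∈ J.dom k) : J.Partner i k a v :=
  ⟨v, hv, h.triv i k hik hf a ha v hv, fun _ _ _ _ _ hr => hr⟩

theorem Models.snake_triv (h : Models e d g J) {i k : Fin n} (hik : i ≠ k)
    (hf : ∀ f < 2 * e, g 1 f 0 0 = i → g 2 f 0 0 ≠ k) {b a : ℕ} (ha : a ∈ J.dom i) :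
    J.Snake i k b a :=
  fun _ hv _ => h.partner_triv hik hf ha hv

/-- The same device as for arrows, but counting at the source of `f`, so that the excluded edge is
`f` itself. -/
theorem noSnakeCount_lt (h : Models e d g J) (c : Computed n e d g) {f : ℕ} (hf : f < 2 * e)
    {i j : Fin n} (hi : g 1 f 0 0 = i) (hj : g 2 f 0 0 = j) {b a : ℕ} (hb : b < d)
    (ha : a ∈ J.dom i) :
    g 11 (g 1 f 0 0) b a < 1 + (if g 10 f b a ≠ 0 then 1 else 0) ↔
      ∀ k : Fin n, k ≠ i → k ≠ j → J.Snake i k b a := by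
  have had := h.dom_lt i a ha
  rw [c.h11, noSnakeCount, gather_lt_iff hf rfl Iff.rfl]
  constructor
  · intro H k hki hkj
    by_cases hl : ∃ f' < 2 * e, g 1 f' 0 0 = i ∧ g 2 f' 0 0 = k
    · obtain ⟨f', hf', h1, h2⟩ := hl
      refine (noSnake_eq_zero h c hf' h1 h2 hb had).1 (not_not.1 (H f' hf' ?_ (by rw [h1, hi])))
      rintro rfl
      exact hkj (Fin.ext (h2.symm.trans hj))
    · push Not at hl
      exact h.snake_triv (Ne.symm hki) hl ha
  · intro H f' hf' hne h1
    rw [not_not]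
    rw [hi] at h1
    obtain ⟨k, hk⟩ : ∃ k : Fin n, g 2 f' 0 0 = k := ⟨⟨_, h.tgt_lt f' hf'⟩, rfl⟩
    refine (noSnake_eq_zero h c hf' h1 hk hb had).2 (H k (h.ne_fin hf' h1 hk).symm ?_)
    rintro rfl
    exact hne (h.inj _ hf' _ hf (by rw [h1, hi]) (by rw [hk, hj]))

theorem noSnakeCount_eq_zero (h : Models e d g J) (c : Computed n e d g)
    {i : Fin n} {b a : ℕ} (hb : b < d) (ha : a ∈ J.dom i) :
    g 11 i b a = 0 ↔ ∀ k : Fin n, k ≠ i → J.Snake i k b a := by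
  have had := h.dom_lt i a ha
  rw [c.h11, noSnakeCount, gather_eq_zero]
  constructor
  · intro H k hki
    by_cases hl : ∃ f' < 2 * e, g 1 f' 0 0 = i ∧ g 2 f' 0 0 = k
    · obtain ⟨f', hf', h1, h2⟩ := hl
      exact (noSnake_eq_zero h c hf' h1 h2 hb had).1 (not_not.1 (H f' hf' h1 0 one_pos))
    · push Not at hl
      exact h.snake_triv (Ne.symm hki) hl ha
  · intro H f' hf' h1 z _
    rw [not_not]
    obtain ⟨k, hk⟩ : ∃ k : Fin n, g 2 f' 0 0 = k := ⟨⟨_, h.tgt_lt f' hf'⟩, rfl⟩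
    exact (noSnake_eq_zero h c hf' h1 hk hb had).2 (H k (h.ne_fin hf' h1 hk).symm)

theorem substitute_ne_zero (h : Models e d g J) (c : Computed n e d g) {f : ℕ} (hf : f < 2 * e)
    {i j : Fin n} (hi : g 1 f 0 0 = i) (hj : g 2 f 0 0 = j) {b x : ℕ} (hb : b < d) (hx : x < d) :
    g 12 f b x ≠ 0 ↔ ∃ a ∈ J.dom i, a ≠ b ∧ (∀ k : Fin n, k ≠ i → k ≠ j → J.Snake i k b a) ∧
      J.Partner i j a x := by
  rw [c.h12, substitute, ne_eq, gather_id_eq_zero hf]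
  push Not
  constructor
  · rintro ⟨a, ha, hab, h1, h2⟩
    rw [partner_ne_zero h c hf hi hj ha hx] at h2
    -- Having a partner puts `a` into a current relation, hence into the domain.
    obtain ⟨y, -, hy, -⟩ := id h2
    have hai := (J.mem_of_rel (h.ne_fin hf hi hj) hy).1
    exact ⟨a, hai, hab, (noSnakeCount_lt h c hf hi hj hb hai).1 h1, h2⟩
  · rintro ⟨a, ha, hab, h1, h2⟩
    exact ⟨a, h.dom_lt i a ha, hab, (noSnakeCount_lt h c hf hi hj hb ha).2 h1,
      (partner_ne_zero h c hf hi hj (h.dom_lt i a ha) hx).2 h2⟩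

/-- The value `b` of `x_i` is SCSS because of `x_j`. -/
def _root_.BinCSP.SCSSBy (J : BinCSP n) (i j : Fin n) (b : ℕ) : Prop :=
  ∀ c ∈ J.dom j, (b, c) ∈ J.rel i j → ∃ a ∈ J.dom i, a ≠ b ∧
    (∀ k : Fin n, k ≠ i → k ≠ j → J.Snake i k b a) ∧ J.Partner i j a c

theorem noSubstitute_eq_zero (h : Models e d g J) (c : Computed n e d g) {f : ℕ} (hf : f < 2 * e)
    {i j : Fin n} (hi : g 1 f 0 0 = i) (hj : g 2 f 0 0 = j) {b w : ℕ} (hb : b < d) :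
    g 13 f b w = 0 ↔ J.SCSSBy i j b := by
  rw [c.h13, noSubstitute, gather_id_eq_zero hf]
  constructor
  · intro H x hx hr
    have hxd := h.dom_lt j x hx
    exact (substitute_ne_zero h c hf hi hj hb hxd).1 fun h0 =>
      H x hxd ⟨(rel_ne_zero h c.h6 hf hi hj hb hxd).2 hr, h0⟩
  · rintro H x hxd ⟨h1, h2⟩
    rw [rel_ne_zero h c.h6 hf hi hj hb hxd] at h1
    exact (substitute_ne_zero h c hf hi hj hb hxd).2
      (H x (J.mem_of_rel (h.ne_fin hf hi hj) h1).2 h1) h2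

/-- Empty domains need a test of their own: conditioning on a variable without values is vacuous,
and there need not be a listed edge to it. -/
theorem emptyDoms_ne_zero (h : Models e d g J) (c : Computed n e d g) :
    g 15 0 0 0 ≠ 0 ↔ ∃ i, J.dom i = ∅ := by
  rw [c.h15, emptyDoms, ne_eq, gather_eq_zero]
  push Not
  have key : ∀ i : Fin n, g 14 i 0 0 = 0 ↔ J.dom i = ∅ := by
    intro i
    rw [c.h14, domSize, gather_id_eq_zero i.2, Finset.eq_empty_iff_forall_notMem]
    exact ⟨fun H a ha => H a (h.dom_lt i a ha) ((h.dead i a (h.dom_lt i a ha)).2 ha),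
      fun H a ha h0 => H a ((h.dead i a ha).1 h0)⟩
  constructor
  · rintro ⟨f, hf, -, -, -, h0⟩
    exact ⟨⟨f, hf⟩, (key ⟨f, hf⟩).1 h0⟩
  · rintro ⟨i, hi⟩
    exact ⟨i, i.2, rfl, 0, one_pos, (key i).2 hi⟩

theorem uncond_ne_zero (h : Models e d g J) (c : Computed n e d g) {i : Fin n} {b w : ℕ}
    (hb : b < d) :
    g 16 i b w ≠ 0 ↔ ∃ a ∈ J.dom i, a ≠ b ∧ ∀ k : Fin n, k ≠ i → J.Snake i k b a := by
  rw [c.h16, uncond, ne_eq, gather_id_eq_zero i.2]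
  push Not
  constructor
  · rintro ⟨a, ha, hab, h1, h2⟩
    have hai := (h.dead i a ha).1 h1
    exact ⟨a, hai, hab, (noSnakeCount_eq_zero h c hb hai).1 h2⟩
  · rintro ⟨a, ha, hab, h1⟩
    exact ⟨a, h.dom_lt i a ha, hab, (h.dead i a (h.dom_lt i a ha)).2 ha,
      (noSnakeCount_eq_zero h c hb ha).2 h1⟩

theorem condEdges_ne_zero (h : Models e d g J) (c : Computed n e d g) {i : Fin n} {b w : ℕ}
    (hb : b < d) :
    g 17 i b w ≠ 0 ↔ ∃ f < 2 * e, ∃ j : Fin n, g 1 f 0 0 = i ∧ g 2 f 0 0 = j ∧ J.SCSSBy i j b := by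
  rw [c.h17, condEdges, ne_eq, gather_eq_zero]
  push Not
  constructor
  · rintro ⟨f, hf, hi, -, -, h0⟩
    exact ⟨f, hf, ⟨_, h.tgt_lt f hf⟩, hi, rfl, (noSubstitute_eq_zero h c hf hi rfl hb).1 h0⟩
  · rintro ⟨f, hf, j, hi, hj, H⟩
    exact ⟨f, hf, hi, 0, one_pos, (noSubstitute_eq_zero h c hf hi hj hb).2 H⟩

/-- The conditioning variable x_j falls under one of three cases: its domain is empty, it is reached
by a listed edge, or its constraint is trivial and its domain nonempty. In the last case the
substitute for one value of x_j also has the snake towards x_j, so it is unconditional. An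
unconditional substitute conversely works with any x_j, which exists because `2 ≤ n`. -/
theorem scss_ne_zero (h : Models e d g J) (c : Computed n e d g) (hn : 2 ≤ n) {k v w : ℕ}
    (hv : v < d) : g 18 k v w ≠ 0 ↔ w = 0 ∧ ∃ hk : k < n, J.SCSS ⟨k, hk⟩ v := by
  rcases Nat.lt_or_ge k n with hk | hk
  swap
  · rw [c.h18, scss, gather_id_of_le hk]
    simp [hk]
  rw [c.h18, scss, ne_eq, gather_id_eq_zero hk]
  have e5 := h.dead ⟨k, hk⟩ v hv
  have e15 := emptyDoms_ne_zero h c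
  have e16 := uncond_ne_zero (i := ⟨k, hk⟩) (w := 0) h c hv
  have e17 := condEdges_ne_zero (i := ⟨k, hk⟩) (w := 0) h c hv
  simp only at e5 e16 e17
  have hand : ¬ (g 15 0 0 0 = 0 ∧ g 16 k v 0 = 0 ∧ g 17 k v 0 = 0) ↔
      g 15 0 0 0 ≠ 0 ∨ g 16 k v 0 ≠ 0 ∨ g 17 k v 0 ≠ 0 := by tauto
  simp only [Nat.lt_one_iff, forall_eq, not_not, hand, e5, e15, e16, e17]
  refine and_congr_right fun _ => ?_
  rw [exists_prop_of_true hk]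
  refine and_congr_right fun hvd => ?_
  change _ ↔ ∃ j : Fin n, j ≠ ⟨k, hk⟩ ∧ J.SCSSBy ⟨k, hk⟩ j v
  constructor
  · rintro (⟨j, hj⟩ | ⟨a, ha, hab, H⟩ | ⟨f, hf, j, h1, h2, H⟩)
    · refine ⟨j, ?_, ?_⟩
      · rintro rfl
        simp [hj] at hvd
      · intro x hx
        simp [hj] at hx
    · obtain ⟨j, hj⟩ : ∃ j : Fin n, j ≠ ⟨k, hk⟩ := by
        have : Nontrivial (Fin n) := Fin.nontrivial_iff_two_le.2 hn
        exact exists_ne _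
      -- The snake towards x_j supplies condition (2).
      exact ⟨j, hj, fun x hx hr => ⟨a, ha, hab, fun l hl _ => H l hl, H j hj x hx hr⟩⟩
    · exact ⟨j, (h.ne_fin hf h1 h2).symm, H⟩
  · rintro ⟨j, hj, H⟩
    by_cases hl : ∃ f < 2 * e, g 1 f 0 0 = k ∧ g 2 f 0 0 = j
    · obtain ⟨f, hf, h1, h2⟩ := hl
      exact Or.inr (Or.inr ⟨f, hf, j, h1, h2, H⟩)
    · push Not at hl
      rcases (J.dom j).eq_empty_or_nonempty with he | ⟨x, hx⟩
      · exact Or.inl ⟨j, he⟩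
      -- The pair of `v` and `x` is allowed since the constraint is trivial, so this one value `x`
      -- already yields the substitute.
      · obtain ⟨a, ha, hab, hs, -⟩ := H x hx (h.triv ⟨k, hk⟩ j hj.symm hl v hvd x hx)
        refine Or.inr (Or.inl ⟨a, ha, hab, fun l hlk => ?_⟩)
        rcases eq_or_ne l j with rfl | hlj
        · exact h.snake_triv hj.symm hl ha
        · exact hs l hlk hlj

/-! ### Invariance of the representation -/

theorem Models.congr (h : Models e d g J) {g' : ℕ → ℕ → ℕ → ℕ → ℕ} (hg : ∀ i < 6, g' i = g i) :
    Models e d g' J := by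
  have l1 := hg 1 (by omega)
  have l2 := hg 2 (by omega)
  have l3 := hg 3 (by omega)
  have l4 := hg 4 (by omega)
  have l5 := hg 5 (by omega)
  constructor
  · rw [l1]; exact h.src_lt
  · rw [l2]; exact h.tgt_lt
  · rw [l1, l2]; exact h.ne
  · rw [l3]; exact h.rev_lt
  · rw [l1, l2, l3]; exact h.src_rev
  · rw [l1, l2, l3]; exact h.tgt_rev
  · rw [l1, l2]; exact h.inj
  · exact h.dom_lt
  · rw [l5]; exact h.dead
  · rw [l1, l2, l4]; exact h.rel
  · rw [l1, l2]; exact h.triv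

/-- One mark suffices because matrices are compared with relations on live values only. Constraints
that have become trivial may remain listed: a model only demands that unlisted constraints are
trivial. -/
theorem Models.elim (h : Models e d g J) (i : Fin n) (b : ℕ) {g' : ℕ → ℕ → ℕ → ℕ → ℕ}
    (h1 : ∀ j < 5, g' j = g j)
    (h5 : ∀ k v, g' 5 k v 0 = if k = i ∧ v = b then 1 else g 5 k v 0) :
    Models e d g' (J.elim i b) := by
  have e1 := h1 1 (by omega)
  have e2 := h1 2 (by omega)
  have e3 := h1 3 (by omega)
  have e4 := h1 4 (by omega)
  have mem : ∀ k a, a ∈ (J.elim i b).dom k ↔ a ∈ J.dom k ∧ ¬ (k = i ∧ a = b) := by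
    intro k a
    rcases eq_or_ne k i with rfl | hk
    · simp [BinCSP.elim, and_comm]
    · simp [BinCSP.elim, hk]
  have rel : ∀ k l a c, a ∈ (J.elim i b).dom k → c ∈ (J.elim i b).dom l →
      ((a, c) ∈ (J.elim i b).rel k l ↔ (a, c) ∈ J.rel k l) := by
    intro k l a c ha hc
    rw [mem] at ha hc
    simp [BinCSP.elim, Finset.mem_filter]
    tauto
  constructor
  · rw [e1]; exact h.src_lt
  · rw [e2]; exact h.tgt_lt
  · rw [e1, e2]; exact h.ne
  · rw [e3]; exact h.rev_lt
  · rw [e1, e2, e3]; exact h.src_rev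
  · rw [e1, e2, e3]; exact h.tgt_rev
  · rw [e1, e2]; exact h.inj
  · exact fun k a ha => h.dom_lt k a ((mem k a).1 ha).1
  · intro k a ha
    rw [h5, mem, ← h.dead k a ha, Fin.ext_iff]
    split_ifs with hc <;> simp [hc]
  · intro f hf k l hk hl a ha c hc
    rw [rel k l a c ha hc, e4]
    rw [e1] at hk
    rw [e2] at hl
    exact h.rel f hf k l hk hl a ((mem _ _).1 ha).1 c ((mem _ _).1 hc).1
  · intro k l hkl hf a ha c hc
    rw [rel k l a c ha hc]
    rw [e1, e2] at hf
    exact h.triv k l hkl hf a ((mem _ _).1 ha).1 c ((mem _ _).1 hc).1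

end

end SCSSTables

/-! ### Layout of the arrays in memory -/

namespace RAM

/-- Parameters of an instance together with a space bound. -/
structure Par where
  n : ℕ
  e : ℕ
  d : ℕ
  B : ℕ
  two_le_n : 2 ≤ n
  one_le_e : 1 ≤ e
  one_le_d : 1 ≤ d
  space : 19 * ((3 + n + 3 * e) * d * d) ≤ B

namespace Par

variable (p : Par)

/-- Range of the first index of the arrays. -/
def N : ℕ := 3 + p.n + 3 * p.e

/-- Size of an array. -/
def S : ℕ := p.N * p.d * p.d

/-- Position of an entry in an array. -/
def idx (k v w : ℕ) : ℕ := (k * p.d + v) * p.d + w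

/-- Address of an entry of the array number `j`. -/
def adr (j k v w : ℕ) : ℕ := j * p.S + p.idx k v w

variable {p}

theorem space' : 19 * p.S ≤ p.B := p.space

theorem N_le : p.N * p.d ≤ p.S := Nat.le_mul_of_pos_right _ p.one_le_d

theorem N_le_S : p.N ≤ p.S := (Nat.le_mul_of_pos_right _ p.one_le_d).trans N_le

theorem d_le_S : p.d ≤ p.S :=
  (Nat.le_mul_of_pos_left _ (by unfold N; omega)).trans (N_le (p := p))

theorem N_le_B : p.N ≤ p.S ∧ p.d ≤ p.S ∧ 19 * p.S ≤ p.B ∧ p.N = 3 + p.n + 3 * p.e ∧ 1 ≤ p.S := by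
  refine ⟨N_le_S, d_le_S, space', rfl, ?_⟩
  have := N_le_S (p := p)
  unfold N at this
  omega

theorem one_le_B : 1 ≤ p.B := by have := N_le_B (p := p); omega

theorem idx_lt {k v w : ℕ} (hk : k < p.N) (hv : v < p.d) (hw : w < p.d) : p.idx k v w < p.S := by
  have h1 : k * p.d + v + 1 ≤ p.N * p.d := by nlinarith
  have h2 : (k * p.d + v + 1) * p.d ≤ p.N * p.d * p.d := Nat.mul_le_mul_right _ h1
  unfold idx S
  rw [Nat.succ_mul] at h2
  omega

theorem idx_inj {k v w k' v' w' : ℕ} (hv : v < p.d) (hw : w < p.d) (hv' : v' < p.d) (hw' : w' < p.d) :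
    p.idx k v w = p.idx k' v' w' ↔ k = k' ∧ v = v' ∧ w = w' := by
  refine ⟨fun h => ?_, by rintro ⟨rfl, rfl, rfl⟩; rfl⟩
  have key : ∀ {a b x y : ℕ}, x < p.d → y < p.d → a * p.d + x = b * p.d + y → a = b ∧ x = y := by
    intro a b x y hx hy hxy
    have h1 := congrArg (· / p.d) hxy
    have h2 := congrArg (· % p.d) hxy
    simp only [Nat.mul_comm _ p.d] at h1 h2
    rw [Nat.mul_add_div p.one_le_d, Nat.mul_add_div p.one_le_d, Nat.div_eq_of_lt hx,
      Nat.div_eq_of_lt hy] at h1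
    rw [Nat.mul_add_mod, Nat.mul_add_mod, Nat.mod_eq_of_lt hx, Nat.mod_eq_of_lt hy] at h2
    exact ⟨by simpa using h1, h2⟩
  obtain ⟨h1, rfl⟩ := key hw hw' h
  obtain ⟨rfl, rfl⟩ := key hv hv' h1
  exact ⟨rfl, rfl, rfl⟩

theorem exists_idx {x : ℕ} (hx : x < p.S) :
    ∃ k < p.N, ∃ v < p.d, ∃ w < p.d, p.idx k v w = x := by
  have hd := p.one_le_d
  refine ⟨x / p.d / p.d, ?_, x / p.d % p.d, Nat.mod_lt _ hd, x % p.d, Nat.mod_lt _ hd, ?_⟩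
  · rw [Nat.div_lt_iff_lt_mul hd, Nat.div_lt_iff_lt_mul hd]
    exact hx
  · rw [idx, Nat.div_add_mod', Nat.div_add_mod']

theorem block_inj {i j x y : ℕ} (hx : x < p.S) (hy : y < p.S) (h : i * p.S + x = j * p.S + y) :
    i = j ∧ x = y := by
  have hS : 0 < p.S := by omega
  have h1 := congrArg (· / p.S) h
  have h2 := congrArg (· % p.S) h
  simp only [Nat.mul_comm _ p.S] at h1 h2
  rw [Nat.mul_add_div hS, Nat.mul_add_div hS, Nat.div_eq_of_lt hx, Nat.div_eq_of_lt hy] at h1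
  rw [Nat.mul_add_mod, Nat.mul_add_mod, Nat.mod_eq_of_lt hx, Nat.mod_eq_of_lt hy] at h2
  exact ⟨by simpa using h1, h2⟩

theorem block_le {j x : ℕ} (hj : j < 19) (hx : x < p.S) : j * p.S + x < p.B := by
  have := space' (p := p)
  have : (j + 1) * p.S ≤ 19 * p.S := Nat.mul_le_mul_right _ hj
  rw [Nat.succ_mul] at this
  omega

theorem adr_lt {j k v w : ℕ} (hj : j < 19) (hk : k < p.N) (hv : v < p.d) (hw : w < p.d) :
    p.adr j k v w < p.B := block_le hj (idx_lt hk hv hw)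

end Par

/-- The registers `1` to `4` hold the parameters. -/
structure Regs (p : Par) (s : State) : Prop where
  r1 : s.reg 1 = p.n
  r2 : s.reg 2 = p.e
  r3 : s.reg 3 = p.d
  r4 : s.reg 4 = p.S

theorem Regs.congr {p : Par} {s s' : State} (h : Regs p s) (hr : ∀ r < 5, s'.reg r = s.reg r) :
    Regs p s' :=
  ⟨by rw [hr 1 (by omega), h.r1], by rw [hr 2 (by omega), h.r2], by rw [hr 3 (by omega), h.r3],
    by rw [hr 4 (by omega), h.r4]⟩

/-- The memory holds the arrays `g j` except possibly the one with number `i`. -/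
structure HoldsExcept (p : Par) (i : ℕ) (g : ℕ → ℕ → ℕ → ℕ → ℕ) (s : State) : Prop
    extends Regs p s where
  le : ∀ y, s.mem y ≤ p.B
  rep : ∀ j < 19, j ≠ i → ∀ k < p.N, ∀ v < p.d, ∀ w < p.d, s.mem (p.adr j k v w) = g j k v w

/-- The memory holds the arrays `g j`. -/
structure Holds (p : Par) (g : ℕ → ℕ → ℕ → ℕ → ℕ) (s : State) : Prop extends Regs p s where
  le : ∀ y, s.mem y ≤ p.B
  rep : ∀ j < 19, ∀ k < p.N, ∀ v < p.d, ∀ w < p.d, s.mem (p.adr j k v w) = g j k v w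

/-- Address of an array entry. -/
def Exp.cell (j : ℕ) (a b c : Exp) : Exp :=
  .add (.mul (.lit j) (.reg 4)) (.add (.mul (.add (.mul a (.reg 3)) b) (.reg 3)) c)

/-- An array entry. -/
def Exp.entry (j : ℕ) (a b c : Exp) : Exp := .load (.cell j a b c)

section
variable {p : Par} {s : State} {g : ℕ → ℕ → ℕ → ℕ → ℕ} {i j : ℕ} {a b c : Exp} {k v w : ℕ}

theorem Regs.cell (h : Regs p s) (hj : j < 19) (ha : Ok p.B s a k) (hb : Ok p.B s b v)
    (hc : Ok p.B s c w) (hk : k < p.N) (hv : v < p.d) (hw : w < p.d) :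
    Ok p.B s (.cell j a b c) (p.adr j k v w) := by
  have hB := Par.N_le_B (p := p)
  have h0 := Par.adr_lt hj hk hv hw
  unfold Par.adr Par.idx at h0
  -- As `1 ≤ d`, intermediate values of the address computation do not exceed the address itself,
  -- which is below the space bound.
  have h1 : k * p.d + v ≤ (k * p.d + v) * p.d := Nat.le_mul_of_pos_right _ p.one_le_d
  have r3 := Ok.reg h.r3 (B := p.B) (by omega)
  have main : Ok p.B s (.cell j a b c) (j * p.S + ((k * p.d + v) * p.d + w)) :=
    Ok.add (Ok.mul (Ok.lit (by omega)) (Ok.reg h.r4 (by omega)) (by omega))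
      (Ok.add (Ok.mul (Ok.add (Ok.mul ha r3 (by omega)) hb (by omega)) r3 (by omega)) hc (by omega))
      (by omega)
  exact main

theorem HoldsExcept.entry (h : HoldsExcept p i g s) (hj : j < 19) (hji : j ≠ i)
    (ha : Ok p.B s a k) (hb : Ok p.B s b v)
    (hc : Ok p.B s c w) (hk : k < p.N) (hv : v < p.d) (hw : w < p.d) :
    Ok p.B s (.entry j a b c) (g j k v w) :=
  (Ok.load (h.toRegs.cell hj ha hb hc hk hv hw) (h.le _)).cast (h.rep j hj hji k hk v hv w hw)

end

/-! ### Computing one array from the others -/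

/-- `q` computes the arrays `g'` from the arrays `g`, in time `C * (N * d ^ 3)`. -/
def Does (p : Par) (C : ℕ) (q : Prog) (g g' : ℕ → ℕ → ℕ → ℕ → ℕ) : Prop :=
  ∀ s, Holds p g s → ∃ t s', Run p.B q s t s' ∧ t ≤ C * (p.N * p.d ^ 3) ∧ Holds p g' s'

theorem Does.seq {p : Par} {C C' : ℕ} {q q' : Prog} {g g' g'' : ℕ → ℕ → ℕ → ℕ → ℕ}
    (h : Does p C q g g') (h' : Does p C' q' g' g'') : Does p (C + C') (.seq q q') g g'' := by
  intro s hs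
  obtain ⟨t, s', hr, ht, hs'⟩ := h s hs
  obtain ⟨t', s'', hr', ht', hs''⟩ := h' s' hs'
  exact ⟨_, s'', Run.seq _ _ _ _ _ _ _ hr hr', by rw [add_mul]; omega, hs''⟩

/-- One array is computed: `val` is added to all entries `(κ, v, w)` of the array number `j`. -/
def Prog.phase (j : ℕ) (F Z κ val : Exp) : Prog :=
  .accumulate F (.reg 3) (.reg 3) Z (.cell j κ (.reg 8) (.reg 9)) val

/-- A factor for the running time of `Prog.phase`. -/
def Prog.phaseCost (j : ℕ) (F Z κ val : Exp) : ℕ :=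
  Prog.accumulateCost F (.reg 3) (.reg 3) Z (.cell j κ (.reg 8) (.reg 9)) val

/-- Array `j` starts as zero and the loop body reads only other arrays, so it ends up holding the
accumulated sums. The four ranges multiply to at most N · d · d · d. -/
theorem Does.phase {p : Par} {g : ℕ → ℕ → ℕ → ℕ → ℕ} {j : ℕ} {F Z κ val : Exp} {Fv Zv : ℕ}
    {κf : ℕ → ℕ} {V : ℕ → ℕ → ℕ → ℕ → ℕ} (hj : j < 19) (hg : g j = 0)
    (hF : ∀ s, Regs p s → Ok p.B s F Fv) (hZ : ∀ s, Regs p s → Ok p.B s Z Zv)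
    (hF1 : 1 ≤ Fv) (hFN : Fv ≤ p.N) (hZ1 : 1 ≤ Zv) (hZd : Zv ≤ p.d)
    (hκ : ∀ f < Fv, κf f < p.N)
    (hleaf : ∀ s, HoldsExcept p j g s → s.reg 7 < Fv → s.reg 8 < p.d → s.reg 9 < p.d →
      s.reg 10 < Zv → Ok p.B s κ (κf (s.reg 7)) ∧
        Ok p.B s val (V (s.reg 7) (s.reg 8) (s.reg 9) (s.reg 10)))
    (hle : ∀ k v w, k < p.N → v < p.d → w < p.d → gather Fv Zv κf V k v w ≤ p.B) :
    Does p (Prog.phaseCost j F Z κ val) (.phase j F Z κ val) g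
      (Function.update g j (gather Fv Zv κf V)) := by
  intro s hs
  have hB := Par.N_le_B (p := p)
  have mem := @Finset.mem_range
  -- The block of memory occupied by array `j`.
  let D : Set ℕ := {y | ∃ x < p.S, y = j * p.S + x}
  have hA : ∀ f < Fv, ∀ v < p.d, ∀ w < p.d, ∀ z < Zv, p.adr j (κf f) v w ∈ D :=
    fun f hf v hv w hw _ _ => ⟨_, Par.idx_lt (hκ f hf) hv hw, rfl⟩
  have adds := Adds.accumulate (B := p.B) (D := D) (m := s.mem) (ρ := s.reg) (N₁ := F)
    (N₂ := .reg 3) (N₃ := .reg 3) (N₄ := Z) (a := .cell j κ (.reg 8) (.reg 9)) (e := val)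
    (c₁ := Fv) (c₂ := p.d) (c₃ := p.d) (c₄ := Zv) (A := fun f v w _ => p.adr j (κf f) v w) (V := V)
    (by omega) (by omega) (by omega) (by omega) hF1 p.one_le_d p.one_le_d hZ1
    (fun s' hr => by
      have h := hs.toRegs.congr fun r hr' => hr r (by omega)
      have r3 := Ok.reg h.r3 (B := p.B) (by omega)
      exact ⟨hF s' h, r3, r3, hZ s' h⟩)
    (fun s' hr hm hle h7 h8 h9 h10 => by
      have h : HoldsExcept p j g s' := by
        refine ⟨hs.toRegs.congr fun r hr' => hr r (by omega), hle, ?_⟩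
        intro i hi hij k hk v hv w hw
        rw [hm, hs.rep i hi k hk v hv w hw]
        rintro ⟨x, hx, h⟩
        exact hij (Par.block_inj (Par.idx_lt hk hv hw) hx h).1
      obtain ⟨h1, h2⟩ := hleaf s' h h7 h8 h9 h10
      exact ⟨hA _ h7 _ h8 _ h9 _ h10, h.toRegs.cell hj h1 (Ok.reg rfl (by omega))
        (Ok.reg rfl (by omega)) (hκ _ h7) h8 h9, h2⟩) hA
  generalize hΔ : (fun y => ∑ f ∈ Finset.range Fv, ∑ v ∈ Finset.range p.d, ∑ w ∈ Finset.range p.d,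
    ∑ z ∈ Finset.range Zv, if p.adr j (κf f) v w = y then V f v w z else 0) = Δ at adds
  have off : ∀ y ∉ D, Δ y = 0 := by
    intro y hy
    rw [← hΔ]
    refine Finset.sum_eq_zero fun f hf => Finset.sum_eq_zero fun v hv =>
      Finset.sum_eq_zero fun w hw => Finset.sum_eq_zero fun z hz => if_neg ?_
    rintro rfl
    exact hy (hA f (mem.1 hf) v (mem.1 hv) w (mem.1 hw) z (mem.1 hz))
  -- By injectivity of addresses, only the iterations with the same `v`, `w` and with `κf f = k`
  -- contribute to an entry; these form `gather`.
  have on : ∀ k, ∀ v < p.d, ∀ w < p.d,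
      Δ (p.adr j k v w) = gather Fv Zv κf V k v w := by
    intro k v hv w hw
    rw [← hΔ]
    refine Finset.sum_congr rfl fun f _ => ?_
    rw [Finset.sum_eq_single_of_mem v (mem.2 hv), Finset.sum_eq_single_of_mem w (mem.2 hw)]
    · by_cases h : κf f = k
      · simp [h]
      · rw [if_neg h]
        refine Finset.sum_eq_zero fun z _ => if_neg fun h' => h ?_
        exact ((Par.idx_inj hv hw hv hw).1 (Nat.add_left_cancel h')).1
    · intro w' hw' hne
      refine Finset.sum_eq_zero fun z _ => if_neg fun h' => hne ?_
      exact ((Par.idx_inj hv (mem.1 hw') hv hw).1 (Nat.add_left_cancel h')).2.2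
    · intro v' hv' hne
      refine Finset.sum_eq_zero fun w' hw' => Finset.sum_eq_zero fun z _ => if_neg fun h' => hne ?_
      exact ((Par.idx_inj (mem.1 hv') (mem.1 hw') hv hw).1 (Nat.add_left_cancel h')).2.1
  have bound : ∀ y, s.mem y + Δ y ≤ p.B := by
    intro y
    by_cases hy : y ∈ D
    · obtain ⟨x, hx, rfl⟩ := hy
      obtain ⟨k, hk, v, hv, w, hw, rfl⟩ := Par.exists_idx hx
      have h1 := on k v hv w hw
      have h2 := hs.rep j hj k hk v hv w hw
      rw [hg] at h2
      simp only [Par.adr, Pi.zero_apply] at h1 h2 ⊢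
      rw [h1, h2, zero_add]
      exact hle k v w hk hv hw
    · rw [off y hy, add_zero]
      exact hs.le y
  obtain ⟨t, s', hr, ht, h1, h2⟩ := adds s (fun _ _ => rfl) (fun _ _ => rfl) bound
  refine ⟨t, s', hr, ht.trans ?_, hs.toRegs.congr fun r hr => h1 r (by omega), ?_, ?_⟩
  · refine Nat.mul_le_mul_left _ ?_
    calc Fv * p.d * p.d * Zv ≤ p.N * p.d * p.d * p.d := by gcongr
      _ = p.N * p.d ^ 3 := by ring
  · intro y
    rw [h2]
    exact bound y
  · intro i hi k hk v hv w hw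
    rw [h2]
    rcases eq_or_ne i j with rfl | hij
    · rw [on k v hv w hw, hs.rep i hi k hk v hv w hw, hg]
      simp
    · rw [off, hs.rep i hi k hk v hv w hw, Function.update_of_ne hij, add_zero]
      rintro ⟨x, hx, h⟩
      exact hij (Par.block_inj (Par.idx_lt hk hv hw) hx h).1

end RAM

namespace SCSSTables

/-- The arrays number `6` to `18`, in dependence of those with smaller numbers. -/
def table (n e d : ℕ) (j : ℕ) (g : ℕ → ℕ → ℕ → ℕ → ℕ) : ℕ → ℕ → ℕ → ℕ :=
  match j with
  | 6 => rel e g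
  | 7 => noArrow e d g
  | 8 => noArrowCount e g
  | 9 => partner e d g
  | 10 => noSnake e d g
  | 11 => noSnakeCount e g
  | 12 => substitute e d g
  | 13 => noSubstitute e d g
  | 14 => domSize n d g
  | 15 => emptyDoms n g
  | 16 => uncond n d g
  | 17 => condEdges e g
  | 18 => scss n g
  | _ => g 0

/-- Each array depends on lower-numbered ones only. Computing them in the order of their numbers
therefore never invalidates an earlier one. -/
theorem table_congr {n e d j : ℕ} {g g' : ℕ → ℕ → ℕ → ℕ → ℕ} (hj : 6 ≤ j) (hj' : j < 19)
    (h : ∀ i < j, g i = g' i) : table n e d j g = table n e d j g' := by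
  interval_cases j
  · simp only [table, rel, h 1, h 2, h 4, h 5, Nat.reduceLT]
  · simp only [table, noArrow, h 6, Nat.reduceLT]
  · simp only [table, noArrowCount, h 1, h 7, Nat.reduceLT]
  · simp only [table, partner, h 2, h 3, h 6, h 7, h 8, Nat.reduceLT]
  · simp only [table, noSnake, h 6, h 9, Nat.reduceLT]
  · simp only [table, noSnakeCount, h 1, h 10, Nat.reduceLT]
  · simp only [table, substitute, h 1, h 9, h 10, h 11, Nat.reduceLT]
  · simp only [table, noSubstitute, h 6, h 12, Nat.reduceLT]
  · simp only [table, domSize, h 5, Nat.reduceLT]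
  · simp only [table, emptyDoms, h 14, Nat.reduceLT]
  · simp only [table, uncond, h 5, h 11, Nat.reduceLT]
  · simp only [table, condEdges, h 1, h 13, Nat.reduceLT]
  · simp only [table, scss, h 5, h 15, h 16, h 17, Nat.reduceLT]

/-- The arrays from number `6` up to (not including) number `j` have been computed, the following
ones are still zero. -/
structure Upto (n e d : ℕ) (g₀ : ℕ → ℕ → ℕ → ℕ → ℕ) (j : ℕ) (g : ℕ → ℕ → ℕ → ℕ → ℕ) : Prop where
  low : ∀ i < 6, g i = g₀ i
  mid : ∀ i, 6 ≤ i → i < j → g i = table n e d i g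
  high : ∀ i, j ≤ i → i < 19 → g i = 0

theorem Upto.succ {n e d j : ℕ} {g₀ g : ℕ → ℕ → ℕ → ℕ → ℕ} (h : Upto n e d g₀ j g) (hj : 6 ≤ j)
    (hj' : j < 19) : Upto n e d g₀ (j + 1) (Function.update g j (table n e d j g)) := by
  have tab : ∀ i, 6 ≤ i → i ≤ j →
      table n e d i (Function.update g j (table n e d j g)) = table n e d i g := by
    intro i hi hij
    exact table_congr hi (by omega) fun l hl => Function.update_of_ne (by omega) _ _
  refine ⟨fun i hi => ?_, fun i hi hij => ?_, fun i hi hi' => ?_⟩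
  · rw [Function.update_of_ne (by omega), h.low i hi]
  · rw [tab i hi (by omega)]
    rcases eq_or_ne i j with rfl | hne
    · simp
    · rw [Function.update_of_ne hne, h.mid i hi (by omega)]
  · rw [Function.update_of_ne (by omega), h.high i (by omega) hi']

theorem Upto.computed {n e d : ℕ} {g₀ g : ℕ → ℕ → ℕ → ℕ → ℕ} (h : Upto n e d g₀ 19 g) :
    Computed n e d g where
  h6 := h.mid 6 (by omega) (by omega)
  h7 := h.mid 7 (by omega) (by omega)
  h8 := h.mid 8 (by omega) (by omega)
  h9 := h.mid 9 (by omega) (by omega)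
  h10 := h.mid 10 (by omega) (by omega)
  h11 := h.mid 11 (by omega) (by omega)
  h12 := h.mid 12 (by omega) (by omega)
  h13 := h.mid 13 (by omega) (by omega)
  h14 := h.mid 14 (by omega) (by omega)
  h15 := h.mid 15 (by omega) (by omega)
  h16 := h.mid 16 (by omega) (by omega)
  h17 := h.mid 17 (by omega) (by omega)
  h18 := h.mid 18 (by omega) (by omega)

end SCSSTables

namespace RAM

open SCSSTables

section
variable {p : Par} {s : State} {g : ℕ → ℕ → ℕ → ℕ → ℕ} {j : ℕ}

/-- Counts of 0-1 summands are at most N · d, hence at most the size of an array, and fit into a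
word. -/
theorem Does.phase_of_le_one {F Z κ val : Exp} {Fv Zv : ℕ}
    {κf : ℕ → ℕ} {V : ℕ → ℕ → ℕ → ℕ → ℕ} (hj : j < 19) (hg : g j = 0)
    (hF : ∀ s, Regs p s → Ok p.B s F Fv) (hZ : ∀ s, Regs p s → Ok p.B s Z Zv)
    (hF1 : 1 ≤ Fv ∧ Fv ≤ p.N) (hZ1 : 1 ≤ Zv ∧ Zv ≤ p.d)
    (hκ : ∀ f < Fv, κf f < p.N) (hV : ∀ f v w z, V f v w z ≤ 1)
    (hleaf : ∀ s, HoldsExcept p j g s → s.reg 7 < Fv → s.reg 8 < p.d → s.reg 9 < p.d →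
      s.reg 10 < Zv → Ok p.B s κ (κf (s.reg 7)) ∧
        Ok p.B s val (V (s.reg 7) (s.reg 8) (s.reg 9) (s.reg 10))) :
    Does p (Prog.phaseCost j F Z κ val) (.phase j F Z κ val) g
      (Function.update g j (gather Fv Zv κf V)) := by
  refine Does.phase hj hg hF hZ hF1.1 hF1.2 hZ1.1 hZ1.2 hκ hleaf fun k v w _ _ _ => ?_
  have h1 := gather_le (F := Fv) (Z := Zv) (κ := κf) (k := k) (M := 1) (V := V) (v := v) (w := w)
    fun f _ z _ => hV f v w z
  have h2 : Fv * (Zv * 1) ≤ p.N * p.d := by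
    rw [mul_one]
    exact Nat.mul_le_mul hF1.2 hZ1.2
  have h3 := Par.N_le (p := p)
  have := Par.N_le_B (p := p)
  omega

theorem Regs.n_ok (h : Regs p s) : Ok p.B s (.reg 1) p.n :=
  Ok.reg h.r1 (by have := Par.N_le_B (p := p); omega)

theorem Regs.e_ok (h : Regs p s) : Ok p.B s (.reg 2) p.e :=
  Ok.reg h.r2 (by have := Par.N_le_B (p := p); omega)

theorem Regs.d_ok (h : Regs p s) : Ok p.B s (.reg 3) p.d :=
  Ok.reg h.r3 (by have := Par.N_le_B (p := p); omega)

theorem Regs.S_ok (h : Regs p s) : Ok p.B s (.reg 4) p.S :=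
  Ok.reg h.r4 (by have := Par.N_le_B (p := p); omega)

theorem Regs.edges_ok (h : Regs p s) : Ok p.B s (.mul (.lit 2) (.reg 2)) (2 * p.e) :=
  Ok.mul (Ok.lit (by have := Par.N_le_B (p := p); omega)) h.e_ok
    (by have := Par.N_le_B (p := p); omega)

theorem one_ok : Ok p.B s (.lit 1) 1 := Ok.lit Par.one_le_B

/-- An index taken from the array number `j`. -/
def Exp.index (j : ℕ) : Exp := .entry j (.reg 7) (.lit 0) (.lit 0)

/-- The array entry `(f, x, y)` for the value `f` of the outer loop variable. -/
def Exp.at (j x y : ℕ) : Exp := .entry j (.reg 7) (.reg x) (.reg y)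

variable {i : ℕ}

theorem HoldsExcept.at (h : HoldsExcept p i g s) (hj : j < 19) (hji : j ≠ i) {x y : ℕ}
    (hf : s.reg 7 < p.N) (hx : s.reg x < p.d) (hy : s.reg y < p.d) :
    Ok p.B s (.at j x y) (g j (s.reg 7) (s.reg x) (s.reg y)) :=
  have hB := Par.N_le_B (p := p)
  h.entry hj hji (Ok.reg rfl (by omega)) (Ok.reg rfl (by omega)) (Ok.reg rfl (by omega)) hf hx hy

theorem HoldsExcept.index (h : HoldsExcept p i g s) (hj : j < 19) (hji : j ≠ i)
    (hf : s.reg 7 < p.N) : Ok p.B s (.index j) (g j (s.reg 7) 0 0) :=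
  have hB := Par.N_le_B (p := p)
  h.entry hj hji (Ok.reg rfl (by omega)) (Ok.lit (by omega)) (Ok.lit (by omega)) hf p.one_le_d
    p.one_le_d

/-- The array entry `(f, x, 0)`. -/
def Exp.at₀ (j x : ℕ) : Exp := .entry j (.reg 7) (.reg x) (.lit 0)

theorem HoldsExcept.at₀ (h : HoldsExcept p i g s) (hj : j < 19) (hji : j ≠ i) {x : ℕ}
    (hf : s.reg 7 < p.N) (hx : s.reg x < p.d) :
    Ok p.B s (.at₀ j x) (g j (s.reg 7) (s.reg x) 0) :=
  have hB := Par.N_le_B (p := p)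
  h.entry hj hji (Ok.reg rfl (by omega)) (Ok.reg rfl (by omega)) (Ok.lit (by omega)) hf hx p.one_le_d

end

/-! ### One round: computing all tables and searching for a value -/

open Exp in
/-- The computations of the arrays `6` to `18`. -/
def Prog.tablePhase {α : Type} (c : (j : ℕ) → (F Z κ val : Exp) → α) (dflt : α) (j : ℕ) : α :=
  let E : Exp := .mul (.lit 2) (.reg 2)
  match j with
  | 6 => c 6 E (.lit 1) (.reg 7) (.mul (nonZero (.at 4 8 9))
      (.mul (isZero (entry 5 (index 1) (.reg 8) (.lit 0)))
        (isZero (entry 5 (index 2) (.reg 9) (.lit 0)))))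
  | 7 => c 7 E (.reg 3) (.reg 7) (.mul (nonZero (.at 6 8 10)) (isZero (.at 6 9 10)))
  | 8 => c 8 E (.lit 1) (index 1) (nonZero (.at 7 8 9))
  | 9 => c 9 E (.reg 3) (.reg 7) (.mul (nonZero (.at 6 8 10))
      (.lt (entry 8 (index 2) (.reg 9) (.reg 10))
        (.add (.lit 1) (nonZero (entry 7 (index 3) (.reg 9) (.reg 10))))))
  | 10 => c 10 E (.reg 3) (.reg 7) (.mul (nonZero (.at 6 8 10)) (isZero (.at 9 9 10)))
  | 11 => c 11 E (.lit 1) (index 1) (nonZero (.at 10 8 9))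
  | 12 => c 12 E (.reg 3) (.reg 7) (.mul (Exp.ne (.reg 10) (.reg 8))
      (.mul (.lt (entry 11 (index 1) (.reg 8) (.reg 10)) (.add (.lit 1) (nonZero (.at 10 8 10))))
        (nonZero (.at 9 10 9))))
  | 13 => c 13 E (.reg 3) (.reg 7) (.mul (nonZero (.at 6 8 10)) (isZero (.at 12 8 10)))
  | 14 => c 14 (.reg 1) (.reg 3) (.reg 7) (isZero (at₀ 5 10))
  | 15 => c 15 (.reg 1) (.lit 1) (.lit 0) (isZero (index 14))
  | 16 => c 16 (.reg 1) (.reg 3) (.reg 7) (.mul (Exp.ne (.reg 10) (.reg 8))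
      (.mul (isZero (at₀ 5 10)) (isZero (.at 11 8 10))))
  | 17 => c 17 E (.lit 1) (index 1) (isZero (at₀ 13 8))
  | 18 => c 18 (.reg 1) (.lit 1) (.reg 7) (.mul (isZero (.reg 9)) (.mul (isZero (at₀ 5 8))
      (isZero (.mul (isZero (entry 15 (.lit 0) (.lit 0) (.lit 0)))
        (.mul (isZero (at₀ 16 8)) (isZero (at₀ 17 8)))))))
  | _ => dflt

/-- The entries of the arrays of directed edges are in range. -/
def InRange (p : Par) (g : ℕ → ℕ → ℕ → ℕ → ℕ) : Prop :=
  ∀ f < 2 * p.e, g 1 f 0 0 < p.n ∧ g 2 f 0 0 < p.n ∧ g 3 f 0 0 < 2 * p.e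

/-- `InRange` is what allows entries of the arrays `1`, `2`, `3` to be used as first indices into
other arrays. -/
theorem Does.tablePhase {p : Par} {g : ℕ → ℕ → ℕ → ℕ → ℕ} (hr : InRange p g) {j : ℕ} (hj : 6 ≤ j)
    (hj' : j < 19) (hg : g j = 0) :
    Does p (Prog.tablePhase Prog.phaseCost 0 j) (Prog.tablePhase Prog.phase .skip j) g
      (Function.update g j (table p.n p.e p.d j g)) := by
  have hB := Par.N_le_B (p := p)
  have hd := p.one_le_d
  have he := p.one_le_e
  have hn := p.two_le_n
  have b1 := Par.one_le_B (p := p)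
  have E := fun s (h : Regs p s) => h.edges_ok
  have En := fun s (h : Regs p s) => h.n_ok
  have Ed := fun s (h : Regs p s) => h.d_ok
  have E1 := fun s (_ : Regs p s) => one_ok (p := p) (s := s)
  have hE : 1 ≤ 2 * p.e ∧ 2 * p.e ≤ p.N := by omega
  have hnN : 1 ≤ p.n ∧ p.n ≤ p.N := by omega
  have hd1 : 1 ≤ p.d ∧ p.d ≤ p.d := by omega
  have h11 : 1 ≤ 1 ∧ 1 ≤ p.d := by omega
  have src : ∀ f < 2 * p.e, g 1 f 0 0 < p.N := fun f hf => by have := (hr f hf).1; omega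
  have tgt : ∀ f < 2 * p.e, g 2 f 0 0 < p.N := fun f hf => by have := (hr f hf).2.1; omega
  have rev : ∀ f < 2 * p.e, g 3 f 0 0 < p.N := fun f hf => by have := (hr f hf).2.2; omega
  have idN : ∀ {F}, 1 ≤ F ∧ F ≤ p.N → ∀ f < F, id f < p.N := fun h f hf => by simp only [id]; omega
  have rg : ∀ (s : State) {r : ℕ}, s.reg r < p.N ∨ s.reg r < p.d → Ok p.B s (.reg r) (s.reg r) :=
    fun s r h => Ok.reg rfl (by omega)
  have o0 : ∀ s : State, Ok p.B s (.lit 0) 0 := fun s => Ok.lit (by omega)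
  have b01 : ∀ (q : Prop) [Decidable q], (if q then 1 else 0) ≤ 1 := fun q _ => by
    split_ifs <;> simp
  have add1 : ∀ (s : State) {x : Exp} {q : Prop} [Decidable q], Ok p.B s x (if q then 1 else 0) →
      Ok p.B s (.add (.lit 1) x) (1 + if q then 1 else 0) := fun s x q _ hx =>
    Ok.add one_ok hx (by have := b01 q; omega)
  interval_cases j
  · refine Does.phase_of_le_one hj' hg E E1 hE h11 (idN hE) (fun _ _ _ _ => b01 _)
      fun s h h7 h8 h9 h10 => ⟨rg s (by omega), ?_⟩
    exact Ok.and (Ok.nonZero (h.at (by omega) (by omega) (by omega) h8 h9) b1)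
      (Ok.and
        (Ok.isZero (h.entry (by omega) (by omega) (h.index (by omega) (by omega) (by omega))
          (rg s (by omega)) (o0 s) (src _ h7) h8 hd) b1)
        (Ok.isZero (h.entry (by omega) (by omega) (h.index (by omega) (by omega) (by omega))
          (rg s (by omega)) (o0 s) (tgt _ h7) h9 hd) b1) b1) b1
  · refine Does.phase_of_le_one hj' hg E Ed hE hd1 (idN hE) (fun _ _ _ _ => b01 _)
      fun s h h7 h8 h9 h10 => ⟨rg s (by omega), ?_⟩
    exact Ok.and (Ok.nonZero (h.at (by omega) (by omega) (by omega) h8 h10) b1)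
      (Ok.isZero (h.at (by omega) (by omega) (by omega) h9 h10) b1) b1
  · refine Does.phase_of_le_one hj' hg E E1 hE h11 src (fun _ _ _ _ => b01 _)
      fun s h h7 h8 h9 h10 => ⟨h.index (by omega) (by omega) (by omega), ?_⟩
    exact Ok.nonZero (h.at (by omega) (by omega) (by omega) h8 h9) b1
  · refine Does.phase_of_le_one hj' hg E Ed hE hd1 (idN hE) (fun _ _ _ _ => b01 _)
      fun s h h7 h8 h9 h10 => ⟨rg s (by omega), ?_⟩
    exact Ok.and (Ok.nonZero (h.at (by omega) (by omega) (by omega) h8 h10) b1)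
      (Ok.lt (h.entry (by omega) (by omega) (h.index (by omega) (by omega) (by omega))
          (rg s (by omega)) (rg s (by omega)) (tgt _ h7) h9 h10)
        (add1 s (Ok.nonZero (h.entry (by omega) (by omega)
          (h.index (by omega) (by omega) (by omega))
          (rg s (by omega)) (rg s (by omega)) (rev _ h7) h9 h10) b1)) b1) b1
  · refine Does.phase_of_le_one hj' hg E Ed hE hd1 (idN hE) (fun _ _ _ _ => b01 _)
      fun s h h7 h8 h9 h10 => ⟨rg s (by omega), ?_⟩
    exact Ok.and (Ok.nonZero (h.at (by omega) (by omega) (by omega) h8 h10) b1)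
      (Ok.isZero (h.at (by omega) (by omega) (by omega) h9 h10) b1) b1
  · refine Does.phase_of_le_one hj' hg E E1 hE h11 src (fun _ _ _ _ => b01 _)
      fun s h h7 h8 h9 h10 => ⟨h.index (by omega) (by omega) (by omega), ?_⟩
    exact Ok.nonZero (h.at (by omega) (by omega) (by omega) h8 h9) b1
  · refine Does.phase_of_le_one hj' hg E Ed hE hd1 (idN hE) (fun _ _ _ _ => b01 _)
      fun s h h7 h8 h9 h10 => ⟨rg s (by omega), ?_⟩
    exact Ok.and (Ok.ne (rg s (by omega)) (rg s (by omega)) b1)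
      (Ok.and (Ok.lt (h.entry (by omega) (by omega) (h.index (by omega) (by omega) (by omega))
          (rg s (by omega)) (rg s (by omega)) (src _ h7) h8 h10)
        (add1 s (Ok.nonZero (h.at (by omega) (by omega) (by omega) h8 h10) b1)) b1)
        (Ok.nonZero (h.at (by omega) (by omega) (by omega) h10 h9) b1) b1) b1
  · refine Does.phase_of_le_one hj' hg E Ed hE hd1 (idN hE) (fun _ _ _ _ => b01 _)
      fun s h h7 h8 h9 h10 => ⟨rg s (by omega), ?_⟩
    exact Ok.and (Ok.nonZero (h.at (by omega) (by omega) (by omega) h8 h10) b1)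
      (Ok.isZero (h.at (by omega) (by omega) (by omega) h8 h10) b1) b1
  · refine Does.phase_of_le_one hj' hg En Ed hnN hd1 (idN hnN) (fun _ _ _ _ => b01 _)
      fun s h h7 h8 h9 h10 => ⟨rg s (by omega), ?_⟩
    exact Ok.isZero (h.at₀ (by omega) (by omega) (by omega) h10) b1
  · refine Does.phase_of_le_one hj' hg En E1 hnN h11 (fun _ _ => by omega) (fun _ _ _ _ => b01 _)
      fun s h h7 h8 h9 h10 => ⟨o0 s, ?_⟩
    exact Ok.isZero (h.index (by omega) (by omega) (by omega)) b1
  · refine Does.phase_of_le_one hj' hg En Ed hnN hd1 (idN hnN) (fun _ _ _ _ => b01 _)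
      fun s h h7 h8 h9 h10 => ⟨rg s (by omega), ?_⟩
    exact Ok.and (Ok.ne (rg s (by omega)) (rg s (by omega)) b1)
      (Ok.and (Ok.isZero (h.at₀ (by omega) (by omega) (by omega) h10) b1)
        (Ok.isZero (h.at (by omega) (by omega) (by omega) h8 h10) b1) b1) b1
  · refine Does.phase_of_le_one hj' hg E E1 hE h11 src (fun _ _ _ _ => b01 _)
      fun s h h7 h8 h9 h10 => ⟨h.index (by omega) (by omega) (by omega), ?_⟩
    exact Ok.isZero (h.at₀ (by omega) (by omega) (by omega) h8) b1
  · refine Does.phase_of_le_one hj' hg En E1 hnN h11 (idN hnN) (fun _ _ _ _ => b01 _)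
      fun s h h7 h8 h9 h10 => ⟨rg s (by omega), ?_⟩
    exact Ok.and (Ok.isZero (rg s (by omega)) b1)
      (Ok.and (Ok.isZero (h.at₀ (by omega) (by omega) (by omega) h8) b1)
        (Ok.not (Ok.and (Ok.isZero (h.entry (by omega) (by omega) (o0 s) (o0 s) (o0 s)
            (by omega) hd hd) b1)
          (Ok.and (Ok.isZero (h.at₀ (by omega) (by omega) (by omega) h8) b1)
            (Ok.isZero (h.at₀ (by omega) (by omega) (by omega) h8) b1) b1) b1) b1) b1) b1

/-- The computation of the arrays from number `j` on, `m` in number. -/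
def Prog.tablePhases : ℕ → ℕ → Prog
  | _, 0 => .skip
  | j, m + 1 => .seq (Prog.tablePhase Prog.phase .skip j) (Prog.tablePhases (j + 1) m)

/-- A factor for the running time of `Prog.tablePhases`. -/
def Prog.tablePhasesCost : ℕ → ℕ → ℕ
  | _, 0 => 1
  | j, m + 1 => Prog.tablePhase Prog.phaseCost 0 j + Prog.tablePhasesCost (j + 1) m

theorem Par.one_le_time {p : Par} : 1 ≤ p.N * p.d ^ 3 :=
  Nat.mul_pos (by unfold Par.N; omega) (pow_pos p.one_le_d 3)

theorem run_tablePhases {p : Par} {g₀ : ℕ → ℕ → ℕ → ℕ → ℕ} (hr : InRange p g₀) (m : ℕ) :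
    ∀ j, 6 ≤ j → j + m = 19 → ∀ g s, Upto p.n p.e p.d g₀ j g → Holds p g s →
      ∃ t s' g', Run p.B (Prog.tablePhases j m) s t s' ∧
        t ≤ Prog.tablePhasesCost j m * (p.N * p.d ^ 3) ∧ Holds p g' s' ∧
        Upto p.n p.e p.d g₀ 19 g' := by
  induction m with
  | zero =>
    rintro j - rfl g s hu hs
    refine ⟨1, s, g, Run.skip s, ?_, hs, hu⟩
    simpa [Prog.tablePhasesCost] using Par.one_le_time (p := p)
  | succ m ih =>
    intro j hj hjm g s hu hs
    have hr' : InRange p g := by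
      intro f hf
      rw [hu.low 1 (by omega), hu.low 2 (by omega), hu.low 3 (by omega)]
      exact hr f hf
    obtain ⟨t, s', h1, h2, h3⟩ :=
      Does.tablePhase hr' hj (by omega) (hu.high j le_rfl (by omega)) s hs
    obtain ⟨t', s'', g', h1', h2', h3'⟩ :=
      ih (j + 1) (by omega) (by omega) _ s' (hu.succ hj (by omega)) h3
    refine ⟨_, s'', g', Run.seq _ _ _ _ _ _ _ h1 h1', ?_, h3'⟩
    rw [Prog.tablePhasesCost, add_mul]
    omega

/-- Zeros are written to `c` arrays from number `l` on. -/
def Prog.clear (l c : ℕ) : Prog :=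
  .for 7 (.mul (.lit c) (.reg 4)) (.store (.add (.mul (.lit l) (.reg 4)) (.reg 7)) (.lit 0))

theorem Par.S_le_time {p : Par} : p.S ≤ p.N * p.d ^ 3 := by
  have h : p.N * p.d * p.d ≤ p.N * p.d * p.d * p.d := Nat.le_mul_of_pos_right _ p.one_le_d
  calc p.S = p.N * p.d * p.d := rfl
    _ ≤ _ := h
    _ = _ := by ring

/-- Phases add to their array instead of overwriting it, so the results of an earlier round have to
be erased. -/
theorem Does.clear {p : Par} {g : ℕ → ℕ → ℕ → ℕ → ℕ} {l c : ℕ} (hl : l + c ≤ 19) (hc : c < 19) :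
    Does p (c * 30 + 30) (.clear l c) g (fun j => if l ≤ j ∧ j < l + c then 0 else g j) := by
  intro s hs
  have hB := Par.N_le_B (p := p)
  have hcS : c * p.S ≤ 18 * p.S := Nat.mul_le_mul_right _ (by omega)
  have hlS : (l + c) * p.S ≤ 19 * p.S := Nat.mul_le_mul_right _ hl
  rw [add_mul] at hlS
  obtain ⟨t, s', hr, ht, -, h1, h2, h3⟩ := Run.for (B := p.B) (x := 7) (c := c * p.S) (T := 8)
    (N := .mul (.lit c) (.reg 4))
    (p := .store (.add (.mul (.lit l) (.reg 4)) (.reg 7)) (.lit 0))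
    (fun k s' => Regs p s' ∧ (∀ y, l * p.S ≤ y → y < l * p.S + k → s'.mem y = 0) ∧
      ∀ y, (y < l * p.S ∨ l * p.S + k ≤ y) → s'.mem y = s.mem y) (by omega)
    (fun k _ s' h _ => Ok.mul (Ok.lit (by omega)) h.1.S_ok (by omega))
    (by
      rintro k hk s' ⟨h1, h2, h3⟩ hx
      have hst := Run.store_ok (Ok.add (Ok.mul (Ok.lit (by omega)) h1.S_ok (by omega))
        (Ok.reg hx (by omega)) (by omega)) (Ok.lit (B := p.B) (s := s') (k := 0) (by omega))
        (a := .add (.mul (.lit l) (.reg 4)) (.reg 7))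
      refine ⟨_, _, hst, by simp [Exp.cost], hx, h1.congr fun r hr => ?_, ?_, ?_⟩
      · simp [State.setReg, Function.update_of_ne (show r ≠ 7 by omega)]
      · intro y hy hy'
        rcases eq_or_ne y (l * p.S + k) with rfl | hne
        · simp [State.setReg]
        · simp only [State.setReg, Function.update_of_ne hne]
          exact h2 y hy (by omega)
      · intro y hy
        simp only [State.setReg]
        rw [Function.update_of_ne (by omega)]
        exact h3 y (by omega))
    s ⟨hs.toRegs.congr fun r hr => by
      simp [State.setReg, Function.update_of_ne (show r ≠ 7 by omega)],
      fun y _ _ => by omega, fun y _ => rfl⟩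
  refine ⟨t, s', hr, ht.trans ?_, h1, ?_, ?_⟩
  · have h0 := Par.one_le_time (p := p)
    have h1 : c * p.S ≤ c * (p.N * p.d ^ 3) := Nat.mul_le_mul_left _ Par.S_le_time
    simp only [Exp.cost]
    rw [add_mul]
    nlinarith
  · intro y
    rcases lt_or_ge y (l * p.S) with hy | hy
    · rw [h3 y (Or.inl hy)]; exact hs.le y
    · rcases lt_or_ge y (l * p.S + c * p.S) with hy' | hy'
      · rw [h2 y hy hy']; omega
      · rw [h3 y (Or.inr hy')]; exact hs.le y
  · intro j hj k hk v hv w hw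
    have hx := Par.idx_lt hk hv hw
    split_ifs with h
    · have e1 : l * p.S ≤ j * p.S := Nat.mul_le_mul_right _ h.1
      have e2 : (j + 1) * p.S ≤ (l + c) * p.S := Nat.mul_le_mul_right _ h.2
      rw [add_mul, add_mul, one_mul] at e2
      exact h2 _ (by unfold Par.adr; omega) (by unfold Par.adr; omega)
    · rw [h3, hs.rep j hj k hk v hv w hw]
      rw [not_and_or, not_le, not_lt] at h
      rcases h with h | h
      · have e1 : (j + 1) * p.S ≤ l * p.S := Nat.mul_le_mul_right _ h
        rw [add_mul, one_mul] at e1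
        left; unfold Par.adr; omega
      · have e1 : (l + c) * p.S ≤ j * p.S := Nat.mul_le_mul_right _ h
        rw [add_mul] at e1
        right; unfold Par.adr; omega

/-- Search for a nonzero entry in the array number `18`; the register `5` tells whether there is
one, and then the register `6` holds the corresponding address in the array number `5`. -/
def Prog.search : Prog :=
  .seq (.assign 5 (.lit 0))
    (.for 7 (.reg 4) (.ite (.load (.add (.mul (.lit 18) (.reg 4)) (.reg 7)))
      (.seq (.assign 5 (.lit 1)) (.assign 6 (.add (.mul (.lit 5) (.reg 4)) (.reg 7)))) .skip))

/-- Equal offsets in the arrays `18` and `5` belong to the same indices, so translating the offset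
gives the cell in which an elimination is to be marked. If there are several candidates, the scan
keeps the last. -/
theorem run_search {p : Par} {g : ℕ → ℕ → ℕ → ℕ → ℕ} {s : State} (hs : Holds p g s) :
    ∃ t s', Run p.B .search s t s' ∧ t ≤ 60 * (p.N * p.d ^ 3) ∧ Holds p g s' ∧
      ((s'.reg 5 = 0 ∧ ∀ k < p.N, ∀ v < p.d, ∀ w < p.d, g 18 k v w = 0) ∨
        (s'.reg 5 = 1 ∧ ∃ k < p.N, ∃ v < p.d, ∃ w < p.d, g 18 k v w ≠ 0 ∧
          s'.reg 6 = p.adr 5 k v w)) := by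
  have hB := Par.N_le_B (p := p)
  obtain ⟨t, s', hr, ht, -, h1, h2, h3⟩ := Run.for (B := p.B) (x := 7) (c := p.S) (T := 20)
    (N := .reg 4)
    (p := .ite (.load (.add (.mul (.lit 18) (.reg 4)) (.reg 7)))
      (.seq (.assign 5 (.lit 1)) (.assign 6 (.add (.mul (.lit 5) (.reg 4)) (.reg 7)))) .skip)
    (fun k s' => Regs p s' ∧ s'.mem = s.mem ∧
      ((s'.reg 5 = 0 ∧ ∀ x < k, s.mem (18 * p.S + x) = 0) ∨
        (s'.reg 5 = 1 ∧ ∃ x < p.S, s.mem (18 * p.S + x) ≠ 0 ∧ s'.reg 6 = 5 * p.S + x))) (by omega)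
    (fun k _ s' h _ => h.1.S_ok)
    (by
      rintro k hk s' ⟨h1, h2, h3⟩ hx
      have oc : Ok p.B s' (.load (.add (.mul (.lit 18) (.reg 4)) (.reg 7))) (s.mem (18 * p.S + k)) :=
        (Ok.load (Ok.add (Ok.mul (Ok.lit (by omega)) h1.S_ok (by omega)) (Ok.reg hx (by omega))
          (by omega)) (by rw [h2]; exact hs.le _)).cast (by rw [h2])
      by_cases hz : s.mem (18 * p.S + k) = 0
      · refine ⟨_, s', Run.ite_false _ _ _ _ _ _ oc.1 (oc.2.trans hz) (Run.skip _),
          by simp [Exp.cost], hx, h1.congr fun r hr => ?_, h2, ?_⟩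
        · simp [State.setReg, Function.update_of_ne (show r ≠ 7 by omega)]
        · rcases h3 with ⟨h3, h4⟩ | h3
          · left
            refine ⟨by simpa [State.setReg] using h3, fun x hx' => ?_⟩
            rcases eq_or_ne x k with rfl | hne
            · exact hz
            · exact h4 x (by omega)
          · right
            simpa [State.setReg] using h3
      · have a1 := Run.assign_ok (s := s') 5 (Ok.lit (B := p.B) (k := 1) (by omega))
        have r1 : Regs p (s'.setReg 5 1) := h1.congr fun r hr => by
          simp [State.setReg, Function.update_of_ne (show r ≠ 5 by omega)]
        have a2 := Run.assign_ok 6 (Ok.add (Ok.mul (Ok.lit (k := 5) (by omega)) r1.S_ok (by omega))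
          (Ok.reg (r := 7) (x := k) (by simpa [State.setReg] using hx) (by omega)) (by omega))
        refine ⟨_, _, Run.ite_true _ _ _ _ _ _ oc.1 (by rw [oc.2]; exact hz)
          (Run.seq _ _ _ _ _ _ _ a1 a2), by simp [Exp.cost], by simpa [State.setReg] using hx,
          h1.congr fun r hr => ?_, h2, Or.inr ⟨by simp [State.setReg], k, hk, hz,
            by simp [State.setReg]⟩⟩
        simp [State.setReg, Function.update_of_ne (show r ≠ 7 by omega),
          Function.update_of_ne (show r ≠ 6 by omega), Function.update_of_ne (show r ≠ 5 by omega)])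
    (s.setReg 5 0) ⟨hs.toRegs.congr fun r hr => by
      simp [State.setReg, Function.update_of_ne (show r ≠ 7 by omega),
        Function.update_of_ne (show r ≠ 5 by omega)], rfl,
      Or.inl ⟨by simp [State.setReg], fun x hx => by omega⟩⟩
  refine ⟨_, s', Run.seq _ _ _ _ _ _ _
    (Run.assign_ok 5 (Ok.lit (Nat.zero_le _))) hr, ?_, ⟨h1, by rw [h2]; exact hs.le,
      by rw [h2]; exact hs.rep⟩, ?_⟩
  · have h0 := Par.one_le_time (p := p)
    have h1 := Par.S_le_time (p := p)
    simp only [Exp.cost] at *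
    omega
  · rcases h3 with ⟨h3, h4⟩ | ⟨h3, x, hx, h4, h5⟩
    · left
      refine ⟨h3, fun k hk v hv w hw => ?_⟩
      rw [← hs.rep 18 (by omega) k hk v hv w hw]
      exact h4 _ (Par.idx_lt hk hv hw)
    · right
      obtain ⟨k, hk, v, hv, w, hw, rfl⟩ := Par.exists_idx hx
      refine ⟨h3, k, hk, v, hv, w, hw, ?_, h5⟩
      rw [← hs.rep 18 (by omega) k hk v hv w hw]
      exact h4

/-- One round: compute all arrays and search for a value that can be eliminated. -/
def Prog.round : Prog := .seq (.clear 6 13) (.seq (.tablePhases 6 13) .search)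

/-- A factor for the running time of `Prog.round`. -/
def Prog.roundCost : ℕ := 420 + Prog.tablePhasesCost 6 13 + 60

theorem run_round {p : Par} {g : ℕ → ℕ → ℕ → ℕ → ℕ} {s : State} (hs : Holds p g s)
    {J : BinCSP p.n} (hJ : Models p.e p.d g J) :
    ∃ t s' g', Run p.B .round s t s' ∧ t ≤ Prog.roundCost * (p.N * p.d ^ 3) ∧ Holds p g' s' ∧
      (∀ i < 6, g' i = g i) ∧
      ((s'.reg 5 = 0 ∧ ¬ J.SCSSPossible) ∨
        (s'.reg 5 = 1 ∧ ∃ (i : Fin p.n) (b : ℕ), J.SCSS i b ∧ s'.reg 6 = p.adr 5 i b 0)) := by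
  obtain ⟨t₁, s₁, r₁, ht₁, hs₁⟩ := Does.clear (g := g) (l := 6) (c := 13) (by omega) (by omega) s hs
  obtain ⟨t₂, s₂, g', r₂, ht₂, hs₂, hu⟩ := run_tablePhases (g₀ := g)
    (fun f hf => ⟨hJ.src_lt f hf, hJ.tgt_lt f hf, hJ.rev_lt f hf⟩) 13 6 le_rfl rfl _ s₁
    ⟨fun i hi => if_neg (by omega), fun i hi hi' => by omega, fun i hi hi' => if_pos (by omega)⟩ hs₁
  obtain ⟨t₃, s₃, r₃, ht₃, hs₃, h⟩ := run_search hs₂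
  have hJ' : Models p.e p.d g' J := hJ.congr hu.low
  have key := fun (k v w : ℕ) (hv : v < p.d) =>
    scss_ne_zero (k := k) (w := w) hJ' hu.computed p.two_le_n hv
  refine ⟨_, s₃, g', Run.seq _ _ _ _ _ _ _ r₁ (Run.seq _ _ _ _ _ _ _ r₂ r₃), ?_, hs₃, hu.low, ?_⟩
  -- The summands are 420 = 13 · 30 + 30 for clearing thirteen arrays, the cost of the phases, and
  -- 60 for the search.
  · rw [Prog.roundCost, add_mul, add_mul]
    omega
  · rcases h with ⟨h1, h2⟩ | ⟨h1, k, hk, v, hv, w, hw, h2, h3⟩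
    · refine Or.inl ⟨h1, ?_⟩
      rintro ⟨i, b, hb⟩
      have hbd := hJ.dom_lt i b hb.1
      have hB := Par.N_le_B (p := p)
      exact (key i b 0 hbd).2 ⟨rfl, i.2, hb⟩ (h2 i (by omega) b hbd 0 p.one_le_d)
    -- Nonzero entries of array `18` have third index `0`, as have the marks in array `5`.
    · obtain ⟨rfl, hkn, h4⟩ := (key k v w hv).1 h2
      exact Or.inr ⟨h1, ⟨k, hkn⟩, v, h4, h3⟩

end RAM

/-! ### Reading the input word -/

namespace BinCSP

theorem getD_flatMap {α : Type*} {g : α → List ℕ} {m : ℕ} (l : List α) (hg : ∀ q ∈ l, (g q).length = m)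
    {f r : ℕ} (hf : f < l.length) (hr : r < m) :
    (l.flatMap g).getD (f * m + r) 0 = (g l[f]).getD r 0 := by
  induction l generalizing f with
  | nil => simp at hf
  | cons q l ih =>
    have hq := hg q (by simp)
    rw [List.flatMap_cons]
    cases f with
    | zero =>
      rw [List.getD_append _ _ _ _ (by omega)]
      simp
    | succ f =>
      rw [Nat.succ_mul, List.getD_append_right _ _ _ _ (by omega)]
      have e : f * m + m + r - (g q).length = f * m + r := by omega
      rw [e, ih (fun x hx => hg x (by simp [hx])) (by simpa using hf)]
      simp

theorem length_flatMap_const {α : Type*} {g : α → List ℕ} {m : ℕ} (l : List α)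
    (hg : ∀ q ∈ l, (g q).length = m) : (l.flatMap g).length = l.length * m := by
  rw [List.length_flatMap, List.map_congr_left hg]
  simp

variable {n : ℕ} (I : BinCSP n) {es : List (Fin n × Fin n)}

theorem Lists.length_eq (h : I.Lists es) : es.length = I.numEdges := by
  rw [numEdges, ← h.2, List.toFinset_card_of_nodup h.1]

/-- The matrix of a constraint in the input. -/
def matrix (p : Fin n × Fin n) : List ℕ :=
  (List.range (I.maxDom * I.maxDom)).map fun z =>
    if (z / I.maxDom, z % I.maxDom) ∈ I.rel p.1 p.2 then 1 else 0

theorem length_matrix (p : Fin n × Fin n) : (I.matrix p).length = I.maxDom * I.maxDom := by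
  simp [matrix]

theorem getD_matrix (p : Fin n × Fin n) {a c : ℕ} (ha : a < I.maxDom) (hc : c < I.maxDom) :
    (I.matrix p).getD (a * I.maxDom + c) 0 = if (a, c) ∈ I.rel p.1 p.2 then 1 else 0 := by
  have h1 : a * I.maxDom + c < I.maxDom * I.maxDom := by
    have : (a + 1) * I.maxDom ≤ I.maxDom * I.maxDom := Nat.mul_le_mul_right _ ha
    rw [add_mul] at this
    omega
  have h2 : (a * I.maxDom + c) / I.maxDom = a := by
    rw [mul_comm, Nat.mul_add_div (by omega), Nat.div_eq_of_lt hc, add_zero]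
  have h3 : (a * I.maxDom + c) % I.maxDom = c := by
    rw [mul_comm, Nat.mul_add_mod, Nat.mod_eq_of_lt hc]
  rw [matrix, List.getD_eq_getElem _ _ (by simpa using h1)]
  simp [h2, h3]

theorem encode_eq (es : List (Fin n × Fin n)) : I.encode es =
    [n, es.length, I.maxDom] ++ (List.ofFn (fun i => (I.dom i).card) ++
      (es.map (fun p => (p.1 : ℕ)) ++ (es.map (fun p => (p.2 : ℕ)) ++ es.flatMap I.matrix))) := by
  simp only [encode, List.append_assoc]
  rfl

theorem length_encode : (I.encode es).length =
    3 + n + 2 * es.length + es.length * (I.maxDom * I.maxDom) := by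
  rw [encode_eq]
  simp only [List.length_append, List.length_ofFn, List.length_map,
    length_flatMap_const es fun q _ => I.length_matrix q, List.length_cons, List.length_nil]
  ring

theorem getD_encode_card (i : Fin n) : (I.encode es).getD (3 + i) 0 = (I.dom i).card := by
  rw [encode_eq, List.getD_append_right _ _ _ _ (by simp),
    List.getD_append _ _ _ _ (by simp)]
  simp

theorem getD_encode_fst {f : ℕ} (hf : f < es.length) :
    (I.encode es).getD (3 + n + f) 0 = es[f].1 := by
  rw [encode_eq, List.getD_append_right _ _ _ _ (by simp; omega),
    List.getD_append_right _ _ _ _ (by simp; omega), List.getD_append _ _ _ _ (by simp; omega)]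
  have : 3 + n + f - [n, es.length, I.maxDom].length -
    (List.ofFn (fun i => (I.dom i).card)).length = f := by simp; omega
  rw [this, List.getD_eq_getElem _ _ (by simpa using hf)]
  simp

theorem getD_encode_snd {f : ℕ} (hf : f < es.length) :
    (I.encode es).getD (3 + n + (f + es.length)) 0 = es[f].2 := by
  rw [encode_eq, List.getD_append_right _ _ _ _ (by simp; omega),
    List.getD_append_right _ _ _ _ (by simp; omega),
    List.getD_append_right _ _ _ _ (by simp; omega), List.getD_append _ _ _ _ (by simp; omega)]
  have : 3 + n + (f + es.length) - [n, es.length, I.maxDom].length -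
    (List.ofFn (fun i => (I.dom i).card)).length - (es.map (fun p => (p.1 : ℕ))).length = f := by
    simp; omega
  rw [this, List.getD_eq_getElem _ _ (by simpa using hf)]
  simp

theorem getD_encode_rel {f : ℕ} (hf : f < es.length) {a c : ℕ} (ha : a < I.maxDom)
    (hc : c < I.maxDom) :
    (I.encode es).getD (3 + n + 2 * es.length + ((f * I.maxDom + a) * I.maxDom + c)) 0 =
      if (a, c) ∈ I.rel es[f].1 es[f].2 then 1 else 0 := by
  rw [encode_eq, List.getD_append_right _ _ _ _ (by simp; omega),
    List.getD_append_right _ _ _ _ (by simp; omega),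
    List.getD_append_right _ _ _ _ (by simp; omega),
    List.getD_append_right _ _ _ _ (by simp; omega)]
  have : 3 + n + 2 * es.length + ((f * I.maxDom + a) * I.maxDom + c) -
      [n, es.length, I.maxDom].length - (List.ofFn (fun i => (I.dom i).card)).length -
      (es.map (fun p => (p.1 : ℕ))).length - (es.map (fun p => (p.2 : ℕ))).length =
      f * (I.maxDom * I.maxDom) + (a * I.maxDom + c) := by
    simp only [List.length_ofFn, List.length_map, List.length_cons, List.length_nil]
    rw [add_mul, mul_assoc]
    omega
  have h1 : a * I.maxDom + c < I.maxDom * I.maxDom := by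
    have : (a + 1) * I.maxDom ≤ I.maxDom * I.maxDom := Nat.mul_le_mul_right _ ha
    rw [add_mul] at this
    omega
  rw [this, getD_flatMap es (fun q _ => I.length_matrix q) hf h1, I.getD_matrix _ ha hc]

theorem card_le_maxDom (i : Fin n) : (I.dom i).card ≤ I.maxDom :=
  Finset.le_sup (f := fun i => (I.dom i).card) (Finset.mem_univ i)

theorem getD_encode_le (x : ℕ) :
    (I.encode es).getD x 0 ≤ 1 + n + es.length + I.maxDom := by
  have key : ∀ y ∈ I.encode es, y ≤ 1 + n + es.length + I.maxDom := by
    intro y hy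
    rw [encode_eq] at hy
    simp only [List.mem_append, List.mem_cons, List.not_mem_nil, or_false, List.mem_ofFn,
      List.mem_map, List.mem_flatMap, matrix] at hy
    rcases hy with (rfl | rfl | rfl) | ⟨i, rfl⟩ | ⟨q, -, rfl⟩ | ⟨q, -, rfl⟩ | ⟨q, -, z, -, rfl⟩
    · omega
    · omega
    · omega
    · have := I.card_le_maxDom i; omega
    · omega
    · omega
    · split_ifs <;> omega
  rcases Nat.lt_or_ge x (I.encode es).length with h | h
  · rw [List.getD_eq_getElem _ _ h]
    exact key _ (List.getElem_mem h)
  · rw [List.getD_eq_default _ _ h]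
    omega

variable {I}

/-- If a domain is empty, the relation and the full product are both empty, and the constraint is
trivial. So `0 < I.numEdges` excludes the degenerate parameters. -/
theorem exists_edge (h : 0 < I.numEdges) : ∃ i j : Fin n, i < j ∧ (I.dom i).Nonempty := by
  obtain ⟨⟨i, j⟩, hp⟩ := Finset.card_pos.1 h
  obtain ⟨hij, hr⟩ := (Finset.mem_filter.1 hp).2
  refine ⟨i, j, hij, Finset.nonempty_iff_ne_empty.2 fun he => hr ?_⟩
  have := I.rel_subset i j hij.ne
  simp only [he, Finset.empty_product, Finset.subset_empty] at this ⊢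
  exact this

theorem two_le_of_edge (h : 0 < I.numEdges) : 2 ≤ n := by
  obtain ⟨i, j, hij, -⟩ := exists_edge h
  have := j.2
  have : (i : ℕ) < j := hij
  omega

theorem one_le_maxDom (h : 0 < I.numEdges) : 1 ≤ I.maxDom := by
  obtain ⟨i, j, -, hi⟩ := exists_edge h
  exact (Finset.card_pos.2 hi).trans_le (I.card_le_maxDom i)

end BinCSP

/-! ### Initialization of the arrays from the input -/

namespace RAM

open SCSSTables

section Init
variable {p : Par} {s : State} {g : ℕ → ℕ → ℕ → ℕ → ℕ} {inp : ℕ → ℕ}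

/-- The array number `0` holds the input. -/
def HasInput (p : Par) (inp : ℕ → ℕ) (g : ℕ → ℕ → ℕ → ℕ → ℕ) : Prop :=
  ∀ k v w, g 0 k v w = inp (p.idx k v w)

theorem HoldsExcept.input {i : ℕ} (h : HoldsExcept p i g s) (hi : i ≠ 0) (hg : HasInput p inp g)
    {x : ℕ} (hx : x < p.S) : s.mem x = inp x := by
  obtain ⟨k, hk, v, hv, w, hw, rfl⟩ := Par.exists_idx hx
  have := h.rep 0 (by omega) hi.symm k hk v hv w hw
  rwa [hg, Par.adr, zero_mul, zero_add] at this

/-- The reverse of a directed edge. -/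
def revEdge (e f : ℕ) : ℕ := if f < e then f + e else f - e

theorem revEdge_lt {e f : ℕ} (hf : f < 2 * e) : revEdge e f < 2 * e := by
  unfold revEdge
  split_ifs <;> omega

/-- The relation of a directed edge in the input. -/
def inputRel (p : Par) (inp : ℕ → ℕ) (f v w : ℕ) : ℕ :=
  if f < p.e then inp (3 + p.n + 2 * p.e + p.idx f v w)
  else inp (3 + p.n + 2 * p.e + p.idx (f - p.e) w v)

/-- The expression for `Par.idx`. -/
def Exp.idx (a b c : Exp) : Exp := .add (.mul (.add (.mul a (.reg 3)) b) (.reg 3)) c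

theorem Regs.idx (h : Regs p s) {a b c : Exp} {k v w : ℕ} (ha : Ok p.B s a k) (hb : Ok p.B s b v)
    (hc : Ok p.B s c w) (hk : k < p.N) (hv : v < p.d) (hw : w < p.d) :
    Ok p.B s (.idx a b c) (p.idx k v w) := by
  have hB := Par.N_le_B (p := p)
  have h0 := Par.idx_lt hk hv hw
  unfold Par.idx at h0
  have h1 : k * p.d + v ≤ (k * p.d + v) * p.d := Nat.le_mul_of_pos_right _ p.one_le_d
  have main : Ok p.B s (.idx a b c) ((k * p.d + v) * p.d + w) :=
    Ok.add (Ok.mul (Ok.add (Ok.mul ha h.d_ok (by omega)) hb (by omega)) h.d_ok (by omega)) hc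
      (by omega)
  exact main

/-- The address `3 + n` in the input. -/
def Exp.base : Exp := .add (.lit 3) (.reg 1)

theorem Regs.base (h : Regs p s) : Ok p.B s .base (3 + p.n) :=
  Ok.add (Ok.lit (by have := Par.N_le_B (p := p); omega)) h.n_ok
    (by have := Par.N_le_B (p := p); omega)

/-- Of the factor 3 + n + 3e in the array size, one e pays for the matrices and the rest for the
other words of the input; hence the input fits into array `0`. -/
theorem input_space : 3 + p.n + 2 * p.e + p.e * (p.d * p.d) ≤ p.S := by
  have h1 : 1 ≤ p.d * p.d := Nat.mul_pos p.one_le_d p.one_le_d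
  have : p.S = (3 + p.n + 2 * p.e) * (p.d * p.d) + p.e * (p.d * p.d) := by
    unfold Par.S Par.N; ring
  have := Nat.le_mul_of_pos_right (3 + p.n + 2 * p.e) h1
  omega

theorem idx_lt_edge {k v w : ℕ} (hk : k < p.e) (hv : v < p.d) (hw : w < p.d) :
    p.idx k v w < p.e * (p.d * p.d) := by
  have h1 : k * p.d + v + 1 ≤ p.e * p.d := by nlinarith
  have h2 : (k * p.d + v + 1) * p.d ≤ p.e * p.d * p.d := Nat.mul_le_mul_right _ h1
  rw [Nat.succ_mul, mul_assoc p.e] at h2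
  unfold Par.idx
  omega

theorem gather_id_one_le {F M : ℕ} {V : ℕ → ℕ → ℕ → ℕ → ℕ} {k v w : ℕ} (h : k < F → V k v w 0 ≤ M) :
    gather F 1 id V k v w ≤ M := by
  rcases Nat.lt_or_ge k F with hk | hk
  · rw [gather_id hk]; simpa using h hk
  · rw [gather_id_of_le hk]; exact Nat.zero_le _

/-- The number of directed edges. -/
def Exp.edges : Exp := .mul (.lit 2) (.reg 2)

/-- The relation of a directed edge in the input. -/
def Exp.inputRel : Exp :=
  .sel (.lt (.reg 7) (.reg 2))
    (.load (.add (.add .base .edges) (.idx (.reg 7) (.reg 8) (.reg 9))))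
    (.load (.add (.add .base .edges) (.idx (.sub (.reg 7) (.reg 2)) (.reg 9) (.reg 8))))

/-- The computation of the arrays `1` to `5`. -/
def Prog.setup {α : Type} (c : (j : ℕ) → (F Z κ val : Exp) → α) (k : α → α → α) : α :=
  k (c 3 .edges (.lit 1) (.reg 7)
      (.sel (.lt (.reg 7) (.reg 2)) (.add (.reg 7) (.reg 2)) (.sub (.reg 7) (.reg 2)))) <|
  k (c 1 .edges (.lit 1) (.reg 7) (.load (.add .base (.reg 7)))) <|
  k (c 2 .edges (.lit 1) (.reg 7) (.load (.add .base (.index 3)))) <|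
  k (c 4 .edges (.lit 1) (.reg 7) .inputRel) <|
  c 5 (.reg 1) (.lit 1) (.reg 7) (.lt (.load (.add (.lit 3) (.reg 7))) (.add (.reg 8) (.lit 1)))

/-- The arrays `1` to `5` before the first round. -/
structure IsSetup (p : Par) (inp : ℕ → ℕ) (g : ℕ → ℕ → ℕ → ℕ → ℕ) : Prop where
  src : ∀ f < 2 * p.e, g 1 f 0 0 = inp (3 + p.n + f)
  tgt : ∀ f < 2 * p.e, g 2 f 0 0 = inp (3 + p.n + revEdge p.e f)
  rev : ∀ f < 2 * p.e, g 3 f 0 0 = revEdge p.e f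
  rel : ∀ f < 2 * p.e, ∀ v < p.d, ∀ w < p.d, g 4 f v w = inputRel p inp f v w
  dead : ∀ i < p.n, ∀ a < p.d, g 5 i a 0 = if inp (3 + i) < a + 1 then 1 else 0

/-- The lists of first and second variables are adjacent in the input, so together they are the
sources of 2e directed edges, with `f` and `f + e` reverse to each other. The target of an edge is
the source of its reverse, which is why array `3` is computed before array `2`. -/
theorem Does.setup (hin : HasInput p inp g) (h0 : ∀ j, 1 ≤ j → g j = 0)
    (hle : ∀ y, inp y ≤ p.B) :
    ∃ g', Does p (Prog.setup Prog.phaseCost (· + ·)) (Prog.setup Prog.phase .seq) g g' ∧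
      IsSetup p inp g' := by
  have hB := Par.N_le_B (p := p)
  have hd := p.one_le_d
  have hn := p.two_le_n
  have b1 := Par.one_le_B (p := p)
  have hsp := input_space (p := p)
  have E := fun s (h : Regs p s) => h.edges_ok
  have En := fun s (h : Regs p s) => h.n_ok
  have E1 := fun s (_ : Regs p s) => one_ok (p := p) (s := s)
  have hE1 : 1 ≤ 2 * p.e := by have := p.one_le_e; omega
  have hE2 : 2 * p.e ≤ p.N := by omega
  have idE : ∀ f < 2 * p.e, id f < p.N := fun f hf => by simp only [id]; omega
  have rg : ∀ (s : State) {r : ℕ}, s.reg r < p.N ∨ s.reg r < p.d → Ok p.B s (.reg r) (s.reg r) :=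
    fun s r h => Ok.reg rfl (by omega)
  let V₃ : ℕ → ℕ → ℕ → ℕ → ℕ := fun f _ _ _ => revEdge p.e f
  let V₁ : ℕ → ℕ → ℕ → ℕ → ℕ := fun f _ _ _ => inp (3 + p.n + f)
  let V₂ : ℕ → ℕ → ℕ → ℕ → ℕ := fun f _ _ _ => inp (3 + p.n + revEdge p.e f)
  let V₄ : ℕ → ℕ → ℕ → ℕ → ℕ := fun f v w _ => inputRel p inp f v w
  let V₅ : ℕ → ℕ → ℕ → ℕ → ℕ := fun f v _ _ => if inp (3 + f) < v + 1 then 1 else 0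
  let g₃ := Function.update g 3 (gather (2 * p.e) 1 id V₃)
  let g₁ := Function.update g₃ 1 (gather (2 * p.e) 1 id V₁)
  let g₂ := Function.update g₁ 2 (gather (2 * p.e) 1 id V₂)
  let g₄ := Function.update g₂ 4 (gather (2 * p.e) 1 id V₄)
  let g₅ := Function.update g₄ 5 (gather p.n 1 id V₅)
  have i3 : HasInput p inp g₃ := hin
  have i1 : HasInput p inp g₁ := hin
  have i2 : HasInput p inp g₂ := hin
  have i4 : HasInput p inp g₄ := hin
  have d3 : Does p _ _ g g₃ := Does.phase (j := 3) (F := .edges) (Z := .lit 1) (κ := .reg 7)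
    (val := .sel (.lt (.reg 7) (.reg 2)) (.add (.reg 7) (.reg 2)) (.sub (.reg 7) (.reg 2)))
    (by omega) (h0 3 (by omega)) E E1 hE1 hE2 le_rfl hd idE
    (fun s h h7 h8 h9 h10 => ⟨rg s (by omega),
      Ok.sel (Ok.lt (rg s (by omega)) h.e_ok b1) (Ok.add (rg s (by omega)) h.e_ok (by omega))
        (Ok.sub (rg s (by omega)) h.e_ok) b1 (by omega) (by omega)⟩)
    (fun k v w _ _ _ => gather_id_one_le fun hk => by have := revEdge_lt hk; simp only [V₃]; omega)
  have d1 : Does p _ _ g₃ g₁ := Does.phase (j := 1) (F := .edges) (Z := .lit 1) (κ := .reg 7)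
    (val := .load (.add .base (.reg 7)))
    (by omega) (h0 1 (by omega)) E E1 hE1 hE2 le_rfl hd idE
    (fun s h h7 h8 h9 h10 => ⟨rg s (by omega),
      (Ok.load (Ok.add h.base (rg s (by omega)) (by omega)) (h.le _)).cast
        (h.input (by omega) i3 (by omega))⟩)
    (fun k v w _ _ _ => gather_id_one_le fun hk => hle _)
  have d2 : Does p _ _ g₁ g₂ := Does.phase (j := 2) (F := .edges) (Z := .lit 1) (κ := .reg 7)
    (val := .load (.add .base (.index 3)))
    (by omega) (h0 2 (by omega)) E E1 hE1 hE2 le_rfl hd idE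
    (fun s h h7 h8 h9 h10 => ⟨rg s (by omega), by
      have hr := revEdge_lt h7
      have ok : Ok p.B s (.index 3) (revEdge p.e (s.reg 7)) :=
        (h.index (by omega) (by omega) (by omega)).cast (by
          change gather (2 * p.e) 1 id V₃ (s.reg 7) 0 0 = _
          rw [gather_id h7]
          simp [V₃])
      exact (Ok.load (Ok.add h.base ok (by omega)) (h.le _)).cast
        (h.input (by omega) i1 (by omega))⟩)
    (fun k v w _ _ _ => gather_id_one_le fun hk => hle _)
  have d4 : Does p _ _ g₂ g₄ := Does.phase (j := 4) (F := .edges) (Z := .lit 1) (κ := .reg 7)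
    (val := .inputRel)
    (by omega) (h0 4 (by omega)) E E1 hE1 hE2 le_rfl hd idE
    (fun s h h7 h8 h9 h10 => ⟨rg s (by omega), by
      have l1 := Par.idx_lt (k := s.reg 7) (by omega) h8 h9
      -- For `f < e` the difference truncates to `0`; the address in the discarded alternative is
      -- thus still in range.
      have l2 := Par.idx_lt (k := s.reg 7 - p.e) (by omega) h9 h8
      have hb := Ok.add h.base h.edges_ok (by omega)
      have := Ok.sel (Ok.lt (rg s (r := 7) (by omega)) h.e_ok b1)
        (Ok.load (Ok.add hb (h.idx (rg s (r := 7) (by omega)) (rg s (r := 8) (by omega))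
          (rg s (r := 9) (by omega)) (by omega) h8 h9) (by omega)) (h.le _))
        (Ok.load (Ok.add hb (h.idx (Ok.sub (rg s (r := 7) (by omega)) h.e_ok)
          (rg s (r := 9) (by omega)) (rg s (r := 8) (by omega)) (by omega) h9 h8) (by omega))
          (h.le _)) b1 (h.le _) (h.le _)
      refine this.cast ?_
      simp only [V₄, RAM.inputRel]
      split_ifs with hc
      · have := idx_lt_edge hc h8 h9
        exact h.input (by omega) i2 (by omega)
      · have := idx_lt_edge (k := s.reg 7 - p.e) (by omega) h9 h8
        exact h.input (by omega) i2 (by omega)⟩)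
    (fun k v w _ _ _ => gather_id_one_le fun hk => by
      simp only [V₄, RAM.inputRel]
      split_ifs
      exacts [hle _, hle _])
  -- A value is dead from the outset if it is at least the domain size; this is expressed by the
  -- strict comparison with `v + 1`.
  have d5 : Does p _ _ g₄ g₅ := Does.phase (j := 5) (F := .reg 1) (Z := .lit 1) (κ := .reg 7)
    (val := .lt (.load (.add (.lit 3) (.reg 7))) (.add (.reg 8) (.lit 1)))
    (by omega) (h0 5 (by omega)) En E1 (by omega) (by omega) le_rfl hd
    (fun f hf => by simp only [id]; omega)
    (fun s h h7 h8 h9 h10 => ⟨rg s (by omega),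
      Ok.lt ((Ok.load (Ok.add (Ok.lit (by omega)) (rg s (by omega)) (by omega)) (h.le _)).cast
        (h.input (by omega) i4 (by omega))) (Ok.add (rg s (by omega)) one_ok (by omega)) b1⟩)
    (fun k v w _ _ _ => gather_id_one_le fun hk => by
      simp only [V₅]
      split_ifs <;> omega)
  refine ⟨g₅, d3.seq (d1.seq (d2.seq (d4.seq d5))), ?_, ?_, ?_, ?_, ?_⟩
  · intro f hf
    change gather (2 * p.e) 1 id V₁ f 0 0 = _
    rw [gather_id hf]
    simp [V₁]
  · intro f hf
    change gather (2 * p.e) 1 id V₂ f 0 0 = _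
    rw [gather_id hf]
    simp [V₂]
  · intro f hf
    change gather (2 * p.e) 1 id V₃ f 0 0 = _
    rw [gather_id hf]
    simp [V₃]
  · intro f hf v _ w _
    change gather (2 * p.e) 1 id V₄ f v w = _
    rw [gather_id hf]
    simp [V₄]
  · intro i hi a _
    change gather p.n 1 id V₅ i a 0 = _
    rw [gather_id hi]
    simp [V₅]

/-- The parameters are stored in the registers `1` to `4`. -/
def Prog.params : Prog :=
  .seq (.assign 1 (.load (.lit 0))) (.seq (.assign 2 (.load (.lit 1))) (.seq
    (.assign 3 (.load (.lit 2)))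
    (.assign 4 (.mul (.mul (.add (.add (.lit 3) (.reg 1)) (.mul (.lit 3) (.reg 2))) (.reg 3))
      (.reg 3)))))

/-- Initialization. -/
def Prog.init : Prog := .seq .params (.setup Prog.phase .seq)

/-- A factor for the running time of `Prog.init`. -/
def Prog.initCost : ℕ := 40 + Prog.setup Prog.phaseCost (· + ·)

theorem run_init {w : List ℕ} (h0 : w.getD 0 0 = p.n) (h1 : w.getD 1 0 = p.e)
    (h2 : w.getD 2 0 = p.d) (hw : w.length ≤ p.S) (hle : ∀ y, w.getD y 0 ≤ p.B) :
    ∃ t s g, Run p.B .init (start w) t s ∧ t ≤ Prog.initCost * (p.N * p.d ^ 3) ∧ Holds p g s ∧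
      IsSetup p (fun x => w.getD x 0) g := by
  have hB := Par.N_le_B (p := p)
  have ld : ∀ (s : State) (k v : ℕ), s.mem = (start w).mem → k ≤ 2 → w.getD k 0 = v →
      Ok p.B s (.load (.lit k)) v := by
    intro s k v hs hk hv
    refine (Ok.load (Ok.lit (by omega)) ?_).cast ?_
    · rw [hs]; exact hle k
    · rw [hs]; exact hv
  let s₁ := (start w).setReg 1 p.n
  let s₂ := s₁.setReg 2 p.e
  let s₃ := s₂.setReg 3 p.d
  let s₄ := s₃.setReg 4 p.S
  have a1 := Run.assign_ok 1 (ld (start w) 0 _ rfl (by omega) h0)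
  have a2 := Run.assign_ok 2 (ld s₁ 1 _ rfl (by omega) h1)
  have a3 := Run.assign_ok 3 (ld s₂ 2 _ rfl (by omega) h2)
  have r1 : s₃.reg 1 = p.n := by simp [s₃, s₂, s₁, State.setReg, Function.update]
  have r2 : s₃.reg 2 = p.e := by simp [s₃, s₂, State.setReg, Function.update]
  have r3 : s₃.reg 3 = p.d := by simp [s₃, State.setReg]
  have hN : Ok p.B s₃ (.add (.add (.lit 3) (.reg 1)) (.mul (.lit 3) (.reg 2))) p.N :=
    Ok.add (Ok.add (Ok.lit (by omega)) (Ok.reg r1 (by omega)) (by omega))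
      (Ok.mul (Ok.lit (by omega)) (Ok.reg r2 (by omega)) (by omega)) (by omega)
  have hNd := Par.N_le (p := p)
  have a4 : Run p.B _ s₃ _ s₄ := Run.assign_ok 4
    (Ok.mul (Ok.mul hN (Ok.reg r3 (by omega)) (by omega)) (Ok.reg r3 (by omega))
      (by change p.S ≤ p.B; omega))
  -- The input ends within array `0`, and later cells are `0`, so all other arrays start as zero.
  let g : ℕ → ℕ → ℕ → ℕ → ℕ := fun j k v x => if j = 0 then w.getD (p.idx k v x) 0 else 0
  have hg : Holds p g s₄ := by
    refine ⟨⟨r1, r2, r3, by simp [s₄, State.setReg]⟩, hle, ?_⟩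
    intro j hj k hk v hv x hx
    have hi := Par.idx_lt hk hv hx
    change w.getD (p.adr j k v x) 0 = _
    rcases Nat.eq_zero_or_pos j with rfl | hj0
    · simp [g, Par.adr]
    · have : 1 * p.S ≤ j * p.S := Nat.mul_le_mul_right _ hj0
      rw [List.getD_eq_default _ _ (by unfold Par.adr; omega)]
      simp [g, hj0.ne']
  obtain ⟨g', hd, hs⟩ := Does.setup (p := p) (g := g) (inp := fun x => w.getD x 0)
    (fun k v x => by simp [g])
    (fun j hj => by funext k v x; simp [g, show j ≠ 0 by omega]) hle
  obtain ⟨t, s', hr, ht, hs'⟩ := hd s₄ hg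
  refine ⟨_, s', g', Run.seq _ _ _ _ _ _ _ (Run.seq _ _ _ _ _ _ _ a1 (Run.seq _ _ _ _ _ _ _ a2
    (Run.seq _ _ _ _ _ _ _ a3 a4))) hr, ?_, hs', hs⟩
  have := Par.one_le_time (p := p)
  simp only [Prog.initCost, add_mul, Exp.cost] at *
  omega

end Init

end RAM

/-! ### The initial arrays represent the given instance -/

namespace RAM

open SCSSTables

section Edges
variable {p : Par} {I : BinCSP p.n} {es : List (Fin p.n × Fin p.n)} {g : ℕ → ℕ → ℕ → ℕ → ℕ}

theorem IsSetup.edge (h : IsSetup p (fun x => (I.encode es).getD x 0) g) (he : es.length = p.e)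
    {q : ℕ} (hq : q < es.length) :
    g 1 q 0 0 = es[q].1 ∧ g 2 q 0 0 = es[q].2 ∧ g 1 (q + p.e) 0 0 = es[q].2 ∧
      g 2 (q + p.e) 0 0 = es[q].1 ∧ g 3 q 0 0 = q + p.e ∧ g 3 (q + p.e) 0 0 = q := by
  have r1 : revEdge p.e q = q + p.e := if_pos (by omega)
  have r2 : revEdge p.e (q + p.e) = q := (if_neg (by omega)).trans (by omega)
  have e1 := I.getD_encode_fst hq
  have e2 := I.getD_encode_snd hq
  rw [he] at e2
  refine ⟨?_, ?_, ?_, ?_, ?_, ?_⟩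
  · rw [h.src q (by omega)]; exact e1
  · rw [h.tgt q (by omega), r1]; exact e2
  · rw [h.src _ (by omega)]; exact e2
  · rw [h.tgt _ (by omega), r2]; exact e1
  · rw [h.rev q (by omega), r1]
  · rw [h.rev _ (by omega), r2]

theorem edge_cases {e f : ℕ} (hf : f < 2 * e) : ∃ q < e, f = q ∨ f = q + e := by
  rcases Nat.lt_or_ge f e with h | h
  · exact ⟨f, h, Or.inl rfl⟩
  · exact ⟨f - e, by omega, Or.inr (by omega)⟩

/-- Listed pairs are increasing and not repeated, so the 2e directed edges are distinct;
completeness of the list makes all unlisted constraints trivial. -/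
theorem IsSetup.models (h : IsSetup p (fun x => (I.encode es).getD x 0) g) (he : I.numEdges = p.e)
    (hd : I.maxDom = p.d) (hnum : I.Numbered) (hes : I.Lists es) : Models p.e p.d g I := by
  have hl : es.length = p.e := (hes.length_eq I).trans he
  have edge := fun {q : ℕ} (hq : q < p.e) => h.edge hl (show q < es.length by omega)
  have lt : ∀ (q : ℕ) (hq : q < es.length), (es[q].1 : ℕ) < es[q].2 := by
    intro q hq
    have : es[q] ∈ I.edges := by rw [← hes.2]; simp
    exact (Finset.mem_filter.1 this).2.1
  have mem : ∀ i : Fin p.n, ∀ a, a ∈ I.dom i ↔ a < (I.dom i).card := by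
    intro i a
    conv_lhs => rw [hnum i]
    exact Finset.mem_range
  have inj : ∀ q q' : ℕ, ∀ (hq : q < es.length) (hq' : q' < es.length),
      (es[q].1 : ℕ) = es[q'].1 → (es[q].2 : ℕ) = es[q'].2 → q = q' := by
    intro q q' hq hq' h1 h2
    exact (hes.1.getElem_inj_iff).1 (Prod.ext (Fin.ext h1) (Fin.ext h2))
  have rel : ∀ (q : ℕ) (hq : q < es.length) (a c : ℕ), a < p.d → c < p.d →
      (I.encode es).getD (3 + p.n + 2 * p.e + p.idx q a c) 0 =
        if (a, c) ∈ I.rel es[q].1 es[q].2 then 1 else 0 := by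
    intro q hq a c ha hc
    have := I.getD_encode_rel hq (a := a) (c := c) (by rwa [hd]) (by rwa [hd])
    rwa [hl, hd] at this
  have dlt : ∀ i, ∀ a ∈ I.dom i, a < p.d := by
    intro i a ha
    exact ((mem i a).1 ha).trans_le (hd ▸ I.card_le_maxDom i)
  -- Only increasing pairs are listed, so the other orientation is obtained from this one by
  -- transposition.
  have triv : ∀ i j : Fin p.n, i < j → (∀ f < 2 * p.e, g 1 f 0 0 = i → g 2 f 0 0 ≠ j) →
      ∀ a ∈ I.dom i, ∀ c ∈ I.dom j, (a, c) ∈ I.rel i j := by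
    intro i j hij hf a ha c hc
    by_contra hr
    have hm : (i, j) ∈ es := by
      rw [← List.mem_toFinset, hes.2]
      refine Finset.mem_filter.2 ⟨Finset.mem_univ _, hij, fun heq => hr ?_⟩
      simp only at heq
      rw [heq]
      exact Finset.mem_product.2 ⟨ha, hc⟩
    obtain ⟨q, hq, hqe⟩ := List.mem_iff_getElem.1 hm
    obtain ⟨h1, h2, -⟩ := edge (show q < p.e by omega)
    rw [hqe] at h1 h2
    exact hf q (by omega) h1 h2
  constructor
  · intro f hf
    obtain ⟨q, hq, rfl | rfl⟩ := edge_cases hf <;> simp only [edge hq, Fin.is_lt]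
  · intro f hf
    obtain ⟨q, hq, rfl | rfl⟩ := edge_cases hf <;> simp only [edge hq, Fin.is_lt]
  · intro f hf
    obtain ⟨q, hq, hfq⟩ := edge_cases hf
    have := lt q (by omega)
    rcases hfq with rfl | rfl <;> simp only [edge hq] <;> omega
  · intro f hf
    rw [h.rev f hf]
    exact revEdge_lt hf
  · intro f hf
    obtain ⟨q, hq, rfl | rfl⟩ := edge_cases hf <;> simp only [edge hq]
  · intro f hf
    obtain ⟨q, hq, rfl | rfl⟩ := edge_cases hf <;> simp only [edge hq]
  · intro f hf f' hf' h1 h2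
    obtain ⟨q, hq, hfq⟩ := edge_cases hf
    obtain ⟨q', hq', hfq'⟩ := edge_cases hf'
    have l1 := lt q (by omega)
    have l2 := lt q' (by omega)
    -- In the mixed cases one edge goes upwards and the other downwards, so they cannot have the
    -- same ends.
    rcases hfq with rfl | rfl <;> rcases hfq' with rfl | rfl <;> simp only [edge hq, edge hq'] at h1 h2
    · exact inj _ _ _ _ h1 h2
    · omega
    · omega
    · rw [inj _ _ _ _ h2 h1]
  · exact dlt
  · intro i a ha
    have hc := I.getD_encode_card (es := es) i
    rw [h.dead i i.2 a ha, mem]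
    simp only [hc]
    by_cases hlt : (I.dom i).card < a + 1
    · simp only [hlt, if_true, one_ne_zero, false_iff]; omega
    · simp only [hlt, if_false, true_iff]; omega
  · intro f hf i j hi hj a ha c hc
    have ha' := dlt i a ha
    have hc' := dlt j c hc
    rw [h.rel f hf a ha' c hc']
    obtain ⟨q, hq, rfl | rfl⟩ := edge_cases hf
    · simp only [edge hq, Fin.val_inj] at hi hj
      rw [inputRel, if_pos hq, rel f (by omega) a c ha' hc', hi, hj]
      simp
    · have hne : i ≠ j := by
        have := lt q (by omega)
        simp only [edge hq] at hi hj
        rintro rfl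
        omega
      simp only [edge hq, Fin.val_inj] at hi hj
      have hqq : q + p.e - p.e = q := by omega
      rw [inputRel, if_neg (by omega), hqq, rel q (by omega) c a hc' ha', hi, hj,
        I.rel_symm i j hne]
      simp
  · intro i j hij hf a ha c hc
    rcases lt_or_gt_of_ne hij with hlt | hgt
    · exact triv i j hlt hf a ha c hc
    · rw [I.rel_symm i j hij]
      refine triv j i hgt (fun f hf' h1 h2 => ?_) c hc a ha
      obtain ⟨q, hq, rfl | rfl⟩ := edge_cases hf'
      · simp only [edge hq] at h1 h2
        refine hf (f + p.e) (by omega) ?_ ?_ <;> simp only [edge hq, h1, h2]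
      · simp only [edge hq] at h1 h2
        refine hf q (by omega) ?_ ?_ <;> simp only [edge hq, h1, h2]

end Edges

/-! ### The two programs -/

section Programs
variable {p : Par} {I : BinCSP p.n} {es : List (Fin p.n × Fin p.n)}

theorem run_init_encode (he : I.numEdges = p.e) (hd : I.maxDom = p.d) (hnum : I.Numbered)
    (hes : I.Lists es) :
    ∃ t s g, Run p.B .init (start (I.encode es)) t s ∧ t ≤ Prog.initCost * (p.N * p.d ^ 3) ∧
      Holds p g s ∧ Models p.e p.d g I := by
  have hl : es.length = p.e := (hes.length_eq I).trans he
  have hB := Par.N_le_B (p := p)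
  obtain ⟨t, s, g, hr, ht, hs, hg⟩ := run_init (p := p) (w := I.encode es)
    (by simp [BinCSP.encode_eq]) (by simp [BinCSP.encode_eq, hl]) (by simp [BinCSP.encode_eq, hd])
    (by rw [I.length_encode, hl, hd]; exact input_space)
    (fun y => (I.getD_encode_le y).trans (by omega))
  exact ⟨t, s, g, hr, ht, hs, hg.models he hd hnum hes⟩

/-- The decision program. -/
def Prog.decide : Prog := .seq .init (.seq .round (.store (.lit 0) (.reg 5)))

theorem run_decide : ∃ c, ∀ (p : Par) (I : BinCSP p.n) (es : List (Fin p.n × Fin p.n)),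
    I.numEdges = p.e → I.maxDom = p.d → I.Numbered → I.Lists es →
    ∃ t s, Run p.B .decide (start (I.encode es)) t s ∧ t ≤ c * (p.N * p.d ^ 3) ∧
      (I.SCSSPossible → s.mem 0 = 1) ∧ (¬ I.SCSSPossible → s.mem 0 = 0) := by
  refine ⟨Prog.initCost + Prog.roundCost + 3, fun p I es he hd hnum hes => ?_⟩
  have hB := Par.N_le_B (p := p)
  obtain ⟨t₁, s₁, g₁, r₁, ht₁, hs₁, hg₁⟩ := run_init_encode he hd hnum hes
  obtain ⟨t₂, s₂, g₂, r₂, ht₂, hs₂, -, h⟩ := run_round hs₁ hg₁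
  have h5 : s₂.reg 5 ≤ 1 := by rcases h with ⟨h, -⟩ | ⟨h, -⟩ <;> omega
  have r₃ := Run.store_ok (Ok.lit (B := p.B) (s := s₂) (k := 0) (by omega))
    (Ok.reg (r := 5) rfl (by omega))
  refine ⟨_, _, Run.seq _ _ _ _ _ _ _ r₁ (Run.seq _ _ _ _ _ _ _ r₂ r₃), ?_, ?_, ?_⟩
  · have := Par.one_le_time (p := p)
    simp only [add_mul, Exp.cost]
    omega
  · intro hp
    rcases h with ⟨-, h⟩ | ⟨h, -⟩
    · exact absurd hp h
    · simp [h]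
  · intro hp
    rcases h with ⟨h, -⟩ | ⟨-, i, b, h, -⟩
    · simp [h]
    · exact absurd ⟨i, b, h⟩ hp

/-- Eliminations until convergence. -/
def Prog.eliminate : Prog :=
  .loop (.reg 5) (.seq .round (.ite (.reg 5) (.store (.reg 6) (.lit 1)) .skip))

theorem elim_size_lt {n : ℕ} {J : BinCSP n} {i : Fin n} {b : ℕ} (hb : b ∈ J.dom i) :
    ∑ k, ((J.elim i b).dom k).card < ∑ k, (J.dom k).card := by
  refine Finset.sum_lt_sum (fun k _ => ?_) ⟨i, Finset.mem_univ i, ?_⟩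
  · rcases eq_or_ne k i with rfl | hk
    · simp only [BinCSP.elim, Function.update_self]
      exact Finset.card_erase_le
    · simp [BinCSP.elim, hk]
  · simp only [BinCSP.elim, Function.update_self]
    exact Finset.card_erase_lt_of_mem hb

theorem Holds.store {g : ℕ → ℕ → ℕ → ℕ → ℕ} {s : State} (h : Holds p g s) {j k v w x : ℕ}
    (hj : j < 19) (hk : k < p.N) (hv : v < p.d) (hw : w < p.d) (hx : x ≤ p.B) :
    Holds p (fun j' k' v' w' => if j' = j ∧ k' = k ∧ v' = v ∧ w' = w then x else g j' k' v' w')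
      ⟨s.reg, Function.update s.mem (p.adr j k v w) x⟩ := by
  refine ⟨h.toRegs.congr fun _ _ => rfl, fun y => ?_, fun j' hj' k' hk' v' hv' w' hw' => ?_⟩
  · simp only [Function.update_apply]
    split_ifs
    exacts [hx, h.le y]
  · simp only [Function.update_apply]
    refine if_congr ⟨fun he => ?_, ?_⟩ rfl (h.rep j' hj' k' hk' v' hv' w' hw')
    · obtain ⟨h1, h2⟩ := Par.block_inj (Par.idx_lt hk' hv' hw') (Par.idx_lt hk hv hw) he
      exact ⟨h1, (Par.idx_inj hv' hw' hv hw).1 h2⟩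
    · rintro ⟨rfl, rfl, rfl, rfl⟩
      rfl

/-- Induction on the number of live values, which each successful round decreases; one more round
finds nothing and ends the loop. The constant `20` covers loop test, branch and marking. -/
theorem run_eliminate (m : ℕ) : ∀ (J : BinCSP p.n) (g : ℕ → ℕ → ℕ → ℕ → ℕ) (s : State),
    ∑ k, (J.dom k).card = m → Models p.e p.d g J → Holds p g s → s.reg 5 = 1 →
    ∃ t s' g' J', Run p.B .eliminate s t s' ∧
      t ≤ (m + 1) * ((Prog.roundCost + 20) * (p.N * p.d ^ 3)) ∧
      Holds p g' s' ∧ Models p.e p.d g' J' ∧ BinCSP.SCSSConverges J J' := by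
  have hB := Par.N_le_B (p := p)
  have h1 := Par.one_le_time (p := p)
  induction m using Nat.strong_induction_on with
  | _ m ih =>
    intro J g s hm hJ hs h5
    have ok := Ok.reg (B := p.B) h5 (by omega)
    have ok₀ : (Exp.reg 5).eval s ≠ 0 := by rw [ok.2]; omega
    obtain ⟨t, s', g', hr, ht, hs', hg', ⟨h0, hn⟩ | ⟨h0, i, b, hb, h6⟩⟩ := run_round hs hJ
    · have ok' := Ok.reg (B := p.B) h0 (by omega)
      have r2 := Run.ite_false (.reg 5) (.store (.reg 6) (.lit 1)) .skip s' s' 1 ok'.1 ok'.2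
        (Run.skip s')
      have r3 := Run.loop_false (.reg 5)
        (.seq .round (.ite (.reg 5) (.store (.reg 6) (.lit 1)) .skip)) s' ok'.1 ok'.2
      refine ⟨_, s', g', J, Run.loop_true _ _ _ _ _ _ _ ok.1 ok₀
        (Run.seq _ _ _ _ _ _ _ hr r2) r3, ?_, hs', hJ.congr hg', .refl, hn⟩
      refine le_trans ?_ (Nat.le_mul_of_pos_left _ (Nat.succ_pos m))
      simp only [Exp.cost, add_mul]
      omega
    · have ok' := Ok.reg (B := p.B) h0 (by omega)
      have hbd := hJ.dom_lt i b hb.1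
      have hiN : (i : ℕ) < p.N := by omega
      have hadr := Par.adr_lt (j := 5) (by omega) hiN hbd p.one_le_d
      have st := Run.store_ok (Ok.reg (B := p.B) h6 hadr.le)
        (Ok.lit (B := p.B) (s := s') (k := 1) (by omega))
      have r2 := Run.ite_true (.reg 5) (.store (.reg 6) (.lit 1)) .skip s' _ _ ok'.1
        (by rw [ok'.2]; omega) st
      have hs₂ := hs'.store (j := 5) (x := 1) (by omega) hiN hbd p.one_le_d (by omega)
      have hJ₂ := hJ.elim i b (g' := fun j' k' v' w' =>
          if j' = 5 ∧ k' = i ∧ v' = b ∧ w' = 0 then 1 else g' j' k' v' w')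
        (fun j hj => by
          funext k v w
          rw [if_neg (by omega), hg' j (by omega)])
        (fun k v => by simp [hg' 5 (by omega)])
      have hlt := elim_size_lt hb.1
      obtain ⟨t₃, s₃, g₃, J', r3, ht₃, hs₃, hJ₃, hc, hn⟩ :=
        ih _ (by omega) (J.elim i b) _ _ rfl hJ₂ hs₂ h0
      refine ⟨_, s₃, g₃, J', Run.loop_true _ _ _ _ _ _ _ ok.1 ok₀
        (Run.seq _ _ _ _ _ _ _ hr r2) r3, ?_, hs₃, hJ₃, .head ⟨i, b, hb, rfl⟩ hc, hn⟩
      have h2 : (∑ k, ((J.elim i b).dom k).card + 1) * ((Prog.roundCost + 20) * (p.N * p.d ^ 3)) ≤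
          m * ((Prog.roundCost + 20) * (p.N * p.d ^ 3)) := Nat.mul_le_mul_right _ (by omega)
      have h3 : (m + 1) * ((Prog.roundCost + 20) * (p.N * p.d ^ 3)) =
          m * ((Prog.roundCost + 20) * (p.N * p.d ^ 3)) +
            (Prog.roundCost * (p.N * p.d ^ 3) + 20 * (p.N * p.d ^ 3)) := by ring
      simp only [Exp.cost]
      omega

/-- The output of the domains. -/
def Prog.output : Prog :=
  .seq (.clear 0 1) (.accumulate (.reg 1) (.reg 3) (.lit 1) (.lit 1)
    (.add (.mul (.reg 7) (.reg 3)) (.reg 8)) (.isZero (.at₀ 5 8)))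

/-- A factor for the running time of `Prog.output`. -/
def Prog.outputCost : ℕ := 60 + Prog.accumulateCost (.reg 1) (.reg 3) (.lit 1) (.lit 1)
    (.add (.mul (.reg 7) (.reg 3)) (.reg 8)) (.isZero (.at₀ 5 8))

theorem sum_ite_mul_add {n d y : ℕ} (hd : 0 < d) (V : ℕ → ℕ → ℕ) :
    (∑ f ∈ Finset.range n, ∑ v ∈ Finset.range d, if f * d + v = y then V f v else 0) =
      if y / d < n then V (y / d) (y % d) else 0 := by
  have key : ∀ f v, v < d → f * d + v = y → f = y / d ∧ v = y % d := by
    rintro f v hv rfl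
    rw [mul_comm, Nat.mul_add_div hd, Nat.div_eq_of_lt hv, Nat.mul_add_mod, Nat.mod_eq_of_lt hv]
    exact ⟨rfl, rfl⟩
  split_ifs with h
  · rw [Finset.sum_eq_single_of_mem (y / d) (Finset.mem_range.2 h),
      Finset.sum_eq_single_of_mem (y % d) (Finset.mem_range.2 (Nat.mod_lt _ hd)),
      if_pos (Nat.div_add_mod' y d)]
    · intro v hv hne
      exact if_neg fun he => hne (key _ _ (Finset.mem_range.1 hv) he).2
    · intro f _ hne
      exact Finset.sum_eq_zero fun v hv =>
        if_neg fun he => hne (key _ _ (Finset.mem_range.1 hv) he).1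
  · refine Finset.sum_eq_zero fun f hf => Finset.sum_eq_zero fun v hv => if_neg fun he => h ?_
    rw [← (key _ _ (Finset.mem_range.1 hv) he).1]
    exact Finset.mem_range.1 hf

/-- The input is no longer needed, so its array is cleared and receives the bits of the domains, in
rows of length d. The two inner loops of the scheme run only once. -/
theorem run_output {g : ℕ → ℕ → ℕ → ℕ → ℕ} {s : State} (hs : Holds p g s) {J : BinCSP p.n}
    (hJ : Models p.e p.d g J) :
    ∃ t s', Run p.B .output s t s' ∧ t ≤ Prog.outputCost * (p.N * p.d ^ 3) ∧
      ∀ (i : Fin p.n) (a : ℕ), a < p.d → s'.mem (i * p.d + a) = if a ∈ J.dom i then 1 else 0 := by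
  have hB := Par.N_le_B (p := p)
  have hd := p.one_le_d
  have hn := p.two_le_n
  have hNd := Par.N_le (p := p)
  obtain ⟨t₁, s₁, r₁, ht₁, hs₁⟩ := Does.clear (g := g) (l := 0) (c := 1) (by omega) (by omega) s hs
  have zero : ∀ y < p.S, s₁.mem y = 0 := by
    intro y hy
    obtain ⟨k, hk, v, hv, w, hw, rfl⟩ := Par.exists_idx hy
    have := hs₁.rep 0 (by omega) k hk v hv w hw
    rwa [Par.adr, zero_mul, zero_add] at this
  have small : ∀ f < p.n, ∀ v < p.d, f * p.d + v < p.S := by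
    intro f hf v hv
    have : (f + 1) * p.d ≤ p.N * p.d := Nat.mul_le_mul_right _ (by omega)
    rw [add_mul] at this
    omega
  let V : ℕ → ℕ → ℕ := fun f v => if g 5 f v 0 = 0 then 1 else 0
  have adds := Adds.accumulate (B := p.B) (D := {y | y < p.S}) (m := s₁.mem) (ρ := s₁.reg)
    (N₁ := .reg 1) (N₂ := .reg 3) (N₃ := .lit 1) (N₄ := .lit 1)
    (a := .add (.mul (.reg 7) (.reg 3)) (.reg 8)) (e := .isZero (.at₀ 5 8))
    (c₁ := p.n) (c₂ := p.d) (c₃ := 1) (c₄ := 1) (A := fun f v _ _ => f * p.d + v)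
    (V := fun f v _ _ => V f v)
    (by omega) (by omega) (by omega) (by omega) (by omega) hd le_rfl le_rfl
    (fun s' hr => by
      have h := hs₁.toRegs.congr fun r hr' => hr r (by omega)
      exact ⟨h.n_ok, h.d_ok, one_ok, one_ok⟩)
    (fun s' hr hm hle h7 h8 h9 h10 => by
      have h : HoldsExcept p 0 g s' := by
        refine ⟨hs₁.toRegs.congr fun r hr' => hr r (by omega), hle, ?_⟩
        intro i hi hi0 k hk v hv w hw
        have : 1 * p.S ≤ i * p.S := Nat.mul_le_mul_right _ (by omega)
        rw [hm, hs₁.rep i hi k hk v hv w hw, if_neg (by omega)]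
        simp only [Set.mem_ofPred_eq, Par.adr]
        omega
      have := small _ h7 _ h8
      exact ⟨this, Ok.add (Ok.mul (Ok.reg rfl (by omega)) h.d_ok (by omega))
        (Ok.reg rfl (by omega)) (by omega),
        Ok.isZero (h.at₀ (by omega) (by omega) (by omega) h8) Par.one_le_B⟩)
    (fun f hf v hv _ _ _ _ => small f hf v hv)
  simp only [Finset.sum_range_one, sum_ite_mul_add hd] at adds
  have V1 : ∀ f v, V f v ≤ 1 := fun f v => by simp only [V]; split_ifs <;> omega
  obtain ⟨t₂, s₂, r₂, ht₂, -, h⟩ := adds s₁ (fun _ _ => rfl) (fun _ _ => rfl) (by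
    intro y
    dsimp only
    split_ifs with hy
    · have := small _ hy _ (Nat.mod_lt y hd)
      rw [Nat.div_add_mod'] at this
      rw [zero y this, zero_add]
      exact (V1 _ _).trans (by omega)
    · exact hs₁.le y)
  refine ⟨_, s₂, Run.seq _ _ _ _ _ _ _ r₁ r₂, ?_, fun i a ha => ?_⟩
  · have h3 : p.n * p.d * 1 * 1 ≤ p.N * p.d ^ 3 := by
      have := Par.S_le_time (p := p)
      have : p.n * p.d ≤ p.N * p.d := Nat.mul_le_mul_right _ (by omega)
      omega
    have := Nat.mul_le_mul_left (Prog.accumulateCost (.reg 1) (.reg 3) (.lit 1) (.lit 1)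
      (.add (.mul (.reg 7) (.reg 3)) (.reg 8)) (.isZero (.at₀ 5 8))) h3
    rw [Prog.outputCost, add_mul]
    omega
  · have e1 : (i * p.d + a) / p.d = i := by
      rw [mul_comm, Nat.mul_add_div hd, Nat.div_eq_of_lt ha, add_zero]
    have e2 : (i * p.d + a) % p.d = a := by
      rw [mul_comm, Nat.mul_add_mod, Nat.mod_eq_of_lt ha]
    rw [h, zero _ (small i i.2 a ha), zero_add]
    dsimp only
    rw [e1, e2, if_pos i.2]
    simp only [V, hJ.dead i a ha]

/-- The program that eliminates until convergence. -/
def Prog.converge : Prog := .seq .init (.seq (.assign 5 (.lit 1)) (.seq .eliminate .output))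

/-- The domains contain at most nd values in total, which bounds the number of eliminations. -/
theorem run_converge : ∃ c, ∀ (p : Par) (I : BinCSP p.n) (es : List (Fin p.n × Fin p.n)),
    I.numEdges = p.e → I.maxDom = p.d → I.Numbered → I.Lists es →
    ∃ t s J, Run p.B .converge (start (I.encode es)) t s ∧ t ≤ c * (p.n * p.d * (p.N * p.d ^ 3)) ∧
      I.SCSSConverges J ∧
      ∀ (i : Fin p.n) (a : ℕ), a < p.d → s.mem (i * p.d + a) = if a ∈ J.dom i then 1 else 0 := by
  refine ⟨Prog.initCost + 2 + 2 * (Prog.roundCost + 20) + Prog.outputCost, fun p I es he hd hnum hes => ?_⟩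
  have hB := Par.N_le_B (p := p)
  obtain ⟨t₁, s₁, g₁, r₁, ht₁, hs₁, hg₁⟩ := run_init_encode he hd hnum hes
  have r₂ := Run.assign_ok (s := s₁) 5 (Ok.lit (B := p.B) (k := 1) (by omega))
  have hs₂ : Holds p g₁ (s₁.setReg 5 1) := ⟨hs₁.toRegs.congr fun r hr => by
    simp [State.setReg, Function.update_of_ne (show r ≠ 5 by omega)], hs₁.le, hs₁.rep⟩
  obtain ⟨t₃, s₃, g₃, J, r₃, ht₃, hs₃, hJ, hc⟩ :=
    run_eliminate _ I g₁ _ rfl hg₁ hs₂ (by simp [State.setReg])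
  obtain ⟨t₄, s₄, r₄, ht₄, h⟩ := run_output hs₃ hJ
  refine ⟨_, s₄, J, Run.seq _ _ _ _ _ _ _ r₁ (Run.seq _ _ _ _ _ _ _ r₂ (Run.seq _ _ _ _ _ _ _
    r₃ r₄)), ?_, hc, h⟩
  have size : ∑ k, (I.dom k).card ≤ p.n * p.d := by
    have := Finset.sum_le_card_nsmul Finset.univ (fun k => (I.dom k).card) p.d
      fun k _ => hd ▸ I.card_le_maxDom k
    simpa using this
  have hnd : 1 ≤ p.n * p.d := Nat.mul_pos (by have := p.two_le_n; omega) p.one_le_d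
  generalize hT : p.N * p.d ^ 3 = T at *
  generalize hM : p.n * p.d = M at *
  have h1 := Par.one_le_time (p := p)
  rw [hT] at h1
  have hTM : T ≤ M * T := Nat.le_mul_of_pos_left _ hnd
  have b1 := Nat.mul_le_mul_left Prog.initCost hTM
  -- Since `1 ≤ M`, the at most `M + 1` rounds are at most `2 * M`.
  have b2 : (∑ k, (I.dom k).card + 1) * ((Prog.roundCost + 20) * T) ≤
      (2 * M) * ((Prog.roundCost + 20) * T) := Nat.mul_le_mul_right _ (by omega)
  have b3 := Nat.mul_le_mul_left Prog.outputCost hTM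
  have e : (Prog.initCost + 2 + 2 * (Prog.roundCost + 20) + Prog.outputCost) * (M * T) =
    Prog.initCost * (M * T) + 2 * (M * T) + (2 * M) * ((Prog.roundCost + 20) * T) +
      Prog.outputCost * (M * T) := by ring
  rw [e]
  simp only [Exp.cost]
  omega

end Programs

/-! ### Bounds in terms of e, n and d -/

/-- The parameters of an instance, for space bounds with a sufficiently large factor `C`. -/
def Par.ofCSP {n K C : ℕ} (I : BinCSP n) (h : 0 < I.numEdges) (hn : n ≤ K * I.numEdges)
    (hC : 19 * (6 + K) ≤ C) : Par where
  n := n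
  e := I.numEdges
  d := I.maxDom
  B := C * (I.numEdges * I.maxDom ^ 2)
  two_le_n := I.two_le_of_edge h
  one_le_e := h
  one_le_d := I.one_le_maxDom h
  space := by
    -- As e ≥ 1 and n ≤ Ke, the three summands are at most 3e, Ke and 3e.
    have h1 : 3 + n + 3 * I.numEdges ≤ (6 + K) * I.numEdges := by rw [add_mul]; omega
    calc 19 * ((3 + n + 3 * I.numEdges) * I.maxDom * I.maxDom)
        ≤ 19 * ((6 + K) * I.numEdges * I.maxDom * I.maxDom) := by gcongr
      _ = 19 * (6 + K) * (I.numEdges * I.maxDom ^ 2) := by ring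
      _ ≤ _ := Nat.mul_le_mul_right _ hC

end RAM

theorem theorem4 :
    -- checking whether some SCSS elimination is possible (the answer is left in memory cell 0)
    (∃ P : RAM.Prog, ∀ K : ℕ, ∃ C : ℕ,
      ∀ (n : ℕ) (I : BinCSP n) (es : List (Fin n × Fin n)),
        I.Numbered → I.Lists es → 0 < I.numEdges → n ≤ K * I.numEdges →
        ∃ (t : ℕ) (s : RAM.State),
          RAM.Run (C * (I.numEdges * I.maxDom ^ 2)) P (RAM.start (I.encode es)) t s ∧
          t ≤ C * (I.numEdges * I.maxDom ^ 3) ∧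
          (I.SCSSPossible → s.mem 0 = 1) ∧ (¬ I.SCSSPossible → s.mem 0 = 0)) ∧
    -- applying SCSS eliminations until convergence (the final domains are left in memory
    -- as an array of bits, indexed by the variables and the values)
    (∃ P : RAM.Prog, ∀ K : ℕ, ∃ C : ℕ,
      ∀ (n : ℕ) (I : BinCSP n) (es : List (Fin n × Fin n)),
        I.Numbered → I.Lists es → 0 < I.numEdges → n ≤ K * I.numEdges →
        ∃ (t : ℕ) (s : RAM.State) (J : BinCSP n),
          RAM.Run (C * (I.numEdges * I.maxDom ^ 2)) P (RAM.start (I.encode es)) t s ∧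
          t ≤ C * (I.numEdges * n * I.maxDom ^ 5) ∧
          I.SCSSConverges J ∧
          ∀ (i : Fin n) (a : ℕ), a < I.maxDom →
            s.mem (i * I.maxDom + a) = if a ∈ J.dom i then 1 else 0) := by
  have hN : ∀ {n K e : ℕ}, 0 < e → n ≤ K * e → 3 + n + 3 * e ≤ (6 + K) * e := by
    intro n K e he hn
    rw [add_mul]
    omega
  constructor
  · obtain ⟨c, run⟩ := RAM.run_decide
    -- One constant for both bounds: `19 * (6 + K)` is needed for space and `c * (6 + K)` for time.
    -- The program is chosen before `K`.
    refine ⟨.decide, fun K => ⟨(c + 19) * (6 + K), fun n I es hnum hes he hn => ?_⟩⟩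
    obtain ⟨t, s, hr, ht, h⟩ := run (.ofCSP I he hn
      (Nat.mul_le_mul_right (6 + K) (Nat.le_add_left 19 c))) I es rfl rfl hnum hes
    refine ⟨t, s, hr, ht.trans ?_, h⟩
    calc c * ((3 + n + 3 * I.numEdges) * I.maxDom ^ 3)
        ≤ (c + 19) * (((6 + K) * I.numEdges) * I.maxDom ^ 3) :=
          Nat.mul_le_mul (Nat.le_add_right _ _) (Nat.mul_le_mul_right _ (hN he hn))
      _ = _ := by ring
  · obtain ⟨c, run⟩ := RAM.run_converge
    refine ⟨.converge, fun K => ⟨(c + 19) * (6 + K), fun n I es hnum hes he hn => ?_⟩⟩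
    obtain ⟨t, s, J, hr, ht, h⟩ := run (.ofCSP I he hn
      (Nat.mul_le_mul_right (6 + K) (Nat.le_add_left 19 c))) I es rfl rfl hnum hes
    refine ⟨t, s, J, hr, ht.trans ?_, h⟩
    have hd := I.one_le_maxDom he
    -- The running time is O(end⁴); the additional factor `I.maxDom` is inserted merely to reach the
    -- stated d⁵.
    calc c * (n * I.maxDom * ((3 + n + 3 * I.numEdges) * I.maxDom ^ 3))
        ≤ (c + 19) * (n * I.maxDom * (((6 + K) * I.numEdges) * (I.maxDom ^ 3 * I.maxDom))) :=
          Nat.mul_le_mul (Nat.le_add_right _ _) (Nat.mul_le_mul_left _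
            (Nat.mul_le_mul (hN he hn) (Nat.le_mul_of_pos_right _ hd)))
      _ = _ := by ring
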